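/- A finite thick generalized $n$-gon ($n\ge 3$) is a point-line geometry $\Gamma=(\mathcal P,\mathcal B,\mathbf I)$ with finitely many points and lines such that (i) $\Gamma$ contains no ordinary $k$-gon for $2\le k<n$; (ii) any two elements of $\mathcal P\cup\mathcal B$ are contained in some ordinary $n$-gon in $\Gamma$; (iii) $\Gamma$ contains an ordinary $(n+1)$-gon. It has order $(s,t)$, $s,t>1$, if each point is incident with exactly $t+1$ lines and each line with exactly $s+1$ points (every finite thick generalized polygon has a unique order). Its collinearity matrix is the adjacency matrix of its point graph, in which two distinct points are adjacent if and only if they are incident with a common line. **Theorem.** Let $\Gamma$ be a finite thick generalized $n$-gon and $\Gamma'$ a finite thick generalized $n'$-gon, with collinearity matrices $\mathbf A$ and $\mathbf A'$. Then $\mathrm{spec}(\mathbf A)=\mathrm{spec}(\mathbf A')$ if and only if $n=n'$ and $\Gamma$ and $\Gamma'$ have the same order $(s,t)$. This holds both when $\mathrm{spec}$ denotes the multiset of eigenvalues (counted with multiplicity) and when it denotes the set of eigenvalues. In particular, two finite thick generalized $n$-gons (same $n$) have the same spectrum if and only if they have the same order, and any two finite thick generalized polygons with the same spectrum have the same order.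 -/

import Mathlib

/-- A point-line geometry with point set `P`, line set `L` and incidence relation `Inc`
(the symmetric relation between points and lines is recorded once, as `Inc point line`). -/
structure PointLineGeometry (P : Type*) (L : Type*) where
  Inc : P → L → Prop

namespace PointLineGeometry

/-- An ordinary `k`-gon (`k ≥ 2`) in `Γ`: cyclically indexed families of `k` distinct points and
`k` distinct lines such that the `i`-th line is incident with the `i`-th and the `(i+1)`-st
point. -/
structure OrdinaryGon {P : Type*} {L : Type*} (Γ : PointLineGeometry P L) (k : ℕ) where
  point : ZMod k → P
  line : ZMod k → L
  point_injective : Function.Injective point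
  line_injective : Function.Injective line
  inc_left : ∀ i, Γ.Inc (point i) (line i)
  inc_right : ∀ i, Γ.Inc (point (i + 1)) (line i)

/-- The set of elements (points and lines) of an ordinary `k`-gon. -/
def OrdinaryGon.elements {P : Type*} {L : Type*} {Γ : PointLineGeometry P L} {k : ℕ}
    (c : Γ.OrdinaryGon k) : Set (P ⊕ L) :=
  Set.range (fun i => Sum.inl (c.point i)) ∪ Set.range (fun i => Sum.inr (c.line i))

/-- `Γ` is a thick generalized `n`-gon. -/
structure IsGeneralizedPolygon {P : Type*} {L : Type*} (Γ : PointLineGeometry P L)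
    (n : ℕ) : Prop where
  three_le : 3 ≤ n
  no_small_gon : ∀ k, 2 ≤ k → k < n → IsEmpty (Γ.OrdinaryGon k)
  exists_gon : ∀ x y : P ⊕ L, ∃ c : Γ.OrdinaryGon n, x ∈ c.elements ∧ y ∈ c.elements
  thick : Nonempty (Γ.OrdinaryGon (n + 1))

/-- `Γ` has (finite) order `(s, t)`, where `s, t > 1`: each point is incident with exactly `t + 1`
lines and each line is incident with exactly `s + 1` points. -/
structure HasOrder {P : Type*} {L : Type*} (Γ : PointLineGeometry P L) (s t : ℕ) : Prop where
  one_lt_left : 1 < s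
  one_lt_right : 1 < t
  lines_through : ∀ p, {l | Γ.Inc p l}.ncard = t + 1
  points_on : ∀ l, {p | Γ.Inc p l}.ncard = s + 1

/-- Two geometries have the same order: there is a pair `(s, t)` that is the order of both. -/
def SameOrder {P L P' L' : Type*} (Γ : PointLineGeometry P L)
    (Γ' : PointLineGeometry P' L') : Prop :=
  ∃ s t : ℕ, Γ.HasOrder s t ∧ Γ'.HasOrder s t

/-- The point graph: two distinct points are adjacent when they are collinear. -/
def pointGraph {P : Type*} {L : Type*} (Γ : PointLineGeometry P L) : SimpleGraph P where
  Adj x y := x ≠ y ∧ ∃ l, Γ.Inc x l ∧ Γ.Inc y l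
  symm := ⟨fun _ _ h => ⟨h.1.symm, h.2.imp fun _ hl => ⟨hl.2, hl.1⟩⟩⟩
  loopless := ⟨fun _ h => h.1 rfl⟩

open Classical in
/-- The collinearity matrix: the adjacency matrix of the point graph. -/
noncomputable def collinearityMatrix {P : Type*} {L : Type*} (Γ : PointLineGeometry P L) :
    Matrix P P ℝ :=
  Γ.pointGraph.adjMatrix ℝ

/-- The point spectrum as a multiset: the eigenvalues of the (real symmetric) collinearity matrix,
counted with multiplicity. -/
noncomputable def pointSpectrum {P : Type*} {L : Type*} [Fintype P] [DecidableEq P]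
    (Γ : PointLineGeometry P L) : Multiset ℝ :=
  Γ.collinearityMatrix.charpoly.roots

end PointLineGeometry

/-! The incidence graph is bipartite of diameter `n` without cycles shorter than `2n`, so an element
not opposite `x` and distinct from it has exactly one neighbour nearer to `x`. Counting neighbours
then shows that the matrix of point pairs at distance `2i` is a polynomial of degree `i` in `A`, up
to a factor `t + 1` when `2i = n` (`aeval_distPoly`). Summing, some polynomial `h` of degree `⌊n/2⌋`
satisfies `h(A) = J` (`aeval_hoffmanPoly`), so `(X - s(t+1)) h` annihilates `A`. Since every even
distance up to `n` occurs between points, no nonzero polynomial of degree at most `n/2` does; hence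
the spectrum is the full root set, of size `⌊n/2⌋ + 1` (`spectrum_collinearityMatrix`).

The set of eigenvalues determines `n` and the order. Its size gives `⌊n/2⌋` and its maximum is
`s(t+1)`. For even `n` its minimum is `-(t+1)`. For odd `n` one has `s = t`, and an integrality
argument (`eval_ballPoly_neg_ne_zero`) shows that no `-(t'+1)` with `t' > 0` is an eigenvalue. This
detects the parity of `n`, after which `s` and `t` can be read off.

Conversely, `n`, `s`, `t` determine the trace of every polynomial in `A`: distance matrices other
than the identity have trace `0`, and the number of points is `h(s(t+1))`. These traces determine
the multiplicities. -/

namespace SimpleGraph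

/-! ### Metric properties of the incidence graph, stated abstractly. -/

/-- A connected graph of diameter at most `n` in which distances to adjacent vertices differ and
in which a vertex `y` at distance less than `n` from `x` has at most one neighbour closer to `x`:
the metric properties of the incidence graph of a generalized `n`-gon. -/
structure HasProjections {V : Type*} (G : SimpleGraph V) (n : ℕ) : Prop where
  connected : G.Connected
  dist_le : ∀ x y, G.dist x y ≤ n
  dist_ne : ∀ x y z, G.Adj y z → G.dist x y ≠ G.dist x z
  proj_unique : ∀ x y z z', G.dist x y < n → G.Adj y z → G.Adj y z' →
    G.dist x z < G.dist x y → G.dist x z' < G.dist x y → z = z'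

namespace HasProjections

variable {V : Type*} {G : SimpleGraph V} {n : ℕ}

lemma dist_adj (h : G.HasProjections n) (x : V) {y z : V} (hyz : G.Adj y z) :
    G.dist x z = G.dist x y + 1 ∨ G.dist x z + 1 = G.dist x y := by
  have h1 := h.dist_ne x y z hyz
  have h2 := h.connected.dist_triangle (u := x) (v := y) (w := z)
  have h3 := h.connected.dist_triangle (u := x) (v := z) (w := y)
  rw [dist_eq_one_iff_adj.2 hyz] at h2
  rw [dist_eq_one_iff_adj.2 hyz.symm] at h3
  omega

lemma exists_proj (h : G.HasProjections n) {x y : V} (hxy : 0 < G.dist x y) :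
    ∃ z, G.Adj y z ∧ G.dist x z + 1 = G.dist x y := by
  obtain ⟨p, hp⟩ := h.connected.exists_walk_length_eq_dist y x
  rw [dist_comm] at hxy
  cases p with
  | nil => simp at hxy
  | @cons _ z _ hadj q =>
    refine ⟨z, hadj, ?_⟩
    have h1 := SimpleGraph.dist_le q
    rw [Walk.length_cons, dist_comm] at hp
    rw [dist_comm] at h1
    rcases h.dist_adj x hadj with h2 | h2 <;> omega

/-- Neighbours of a vertex at distance less than `n` that is not the base vertex: one is
closer, all others are further away. -/
lemma exists_unique_proj (h : G.HasProjections n) {x y : V} (hxy : 0 < G.dist x y)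
    (hn : G.dist x y < n) :
    ∃ z, G.Adj y z ∧ G.dist x z + 1 = G.dist x y ∧
      ∀ z', G.Adj y z' → z' ≠ z → G.dist x z' = G.dist x y + 1 := by
  obtain ⟨z, hz, hd⟩ := h.exists_proj hxy
  refine ⟨z, hz, hd, fun z' hz' hne => ?_⟩
  rcases h.dist_adj x hz' with h2 | h2
  · exact h2
  · exact absurd (h.proj_unique x y z' z hn hz' hz (by omega) (by omega)) hne

lemma dist_of_adj_opposite (h : G.HasProjections n) {x y z : V} (hxy : G.dist x y = n)
    (hz : G.Adj y z) : G.dist x z + 1 = n := by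
  have := h.dist_le x z
  rcases h.dist_adj x hz with h2 | h2 <;> omega

/-- A sequence without backtracking is geodesic up to length `n`. -/
lemma dist_of_nonbacktracking (h : G.HasProjections n) (v : ℕ → V)
    (hadj : ∀ i, G.Adj (v i) (v (i + 1))) (hne : ∀ i, v i ≠ v (i + 2)) (i j : ℕ) (hj : j ≤ n) :
    G.dist (v i) (v (i + j)) = j := by
  induction j using Nat.strong_induction_on with
  | _ j ih =>
    match j with
    | 0 => simp
    | 1 => exact dist_eq_one_iff_adj.2 (hadj i)
    | j + 2 =>
      have h1 := ih (j + 1) (by omega) (by omega)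
      have h0 := ih j (by omega) (by omega)
      rcases h.dist_adj (v i) (hadj (i + (j + 1))) with h2 | h2
      · exact h2.trans (by rw [h1])
      · have := h.proj_unique (v i) (v (i + (j + 1))) (v (i + j)) (v (i + (j + 1) + 1)) (by omega)
          (hadj (i + j)).symm (hadj _) (by omega) (by omega)
        exact absurd this (hne _)

lemma ncard_closer (h : G.HasProjections n) {x y : V} (hxy : 0 < G.dist x y)
    (hn : G.dist x y < n) : {z | G.Adj y z ∧ G.dist x z + 1 = G.dist x y}.ncard = 1 := by
  obtain ⟨z, hz, hd, hz'⟩ := h.exists_unique_proj hxy hn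
  rw [Set.ncard_eq_one]
  refine ⟨z, Set.ext fun w => ⟨fun hw => ?_, ?_⟩⟩
  · by_contra hne
    have := hz' w hw.1 hne
    have := hw.2
    omega
  · rintro rfl
    exact ⟨hz, hd⟩

lemma ncard_further [Finite V] (h : G.HasProjections n) {x y : V} (hxy : 0 < G.dist x y)
    (hn : G.dist x y < n) :
    {z | G.Adj y z ∧ G.dist x z = G.dist x y + 1}.ncard + 1 = (G.neighborSet y).ncard := by
  have h1 := h.ncard_closer hxy hn
  rw [← h1, ← Set.ncard_union_eq]
  · rw [h1]
    congr 1
    ext z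
    simp only [Set.mem_union, Set.mem_ofPred_eq, mem_neighborSet, ← and_or_left]
    exact ⟨fun hz => hz.1, fun hz => ⟨hz, h.dist_adj x hz⟩⟩
  · rw [Set.disjoint_left]
    rintro z ⟨-, hz⟩ ⟨-, hz'⟩
    omega

/-- Opposite vertices have equal degree. -/
lemma ncard_neighborSet_le_of_opposite [Finite V] (h : G.HasProjections n) (hn : 2 ≤ n) {x y : V}
    (hxy : G.dist x y = n) : (G.neighborSet x).ncard ≤ (G.neighborSet y).ncard := by
  have hyx : G.dist y x = n := by rw [dist_comm, hxy]
  -- Each neighbour of `x` is sent to its projection among the neighbours of `y`. This is injective: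
  -- the image lies at distance `n - 1` from `x` and so has only one nearer neighbour of `x`.
  have key : ∀ z ∈ G.neighborSet x, ∃ w, G.Adj y w ∧ G.dist z w + 1 = G.dist z y := by
    intro z hz
    refine h.exists_proj ?_
    have := h.dist_of_adj_opposite hyx hz
    rw [dist_comm] at this
    omega
  choose! f hf using key
  refine Set.ncard_le_ncard_of_injOn f (fun z hz => (hf z hz).1) ?_ (Set.toFinite _)
  intro z hz z' hz' hzz
  have h1 := h.dist_of_adj_opposite hyx hz
  have h1' := h.dist_of_adj_opposite hyx hz'
  have h2 := hf z hz
  have h2' := hf z' hz'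
  have h3 := h.dist_of_adj_opposite hxy h2.1
  rw [dist_comm] at h1 h1' h3
  rw [← hzz] at h2'
  refine h.proj_unique (f z) x z z' (by omega) hz hz' ?_ ?_
  · rw [dist_comm (v := z)]; omega
  · rw [dist_comm (v := z')]; omega

lemma ncard_neighborSet_eq_of_opposite [Finite V] (h : G.HasProjections n) (hn : 2 ≤ n) {x y : V}
    (hxy : G.dist x y = n) : (G.neighborSet x).ncard = (G.neighborSet y).ncard :=
  (h.ncard_neighborSet_le_of_opposite hn hxy).antisymm
    (h.ncard_neighborSet_le_of_opposite hn (by rw [dist_comm, hxy]))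

lemma exists_further [Finite V] (h : G.HasProjections n) {x y : V}
    (hdeg : 2 ≤ (G.neighborSet y).ncard) (hn : G.dist x y < n) :
    ∃ z, G.Adj y z ∧ G.dist x z = G.dist x y + 1 := by
  rcases Nat.eq_zero_or_pos (G.dist x y) with h0 | h0
  · obtain ⟨z, hz⟩ := Set.nonempty_of_ncard_ne_zero (s := G.neighborSet y) (by omega)
    refine ⟨z, hz, ?_⟩
    rcases h.dist_adj x hz with h1 | h1 <;> omega
  · have := h.ncard_further h0 hn
    obtain ⟨z, hz⟩ := Set.nonempty_of_ncard_ne_zero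
      (s := {z | G.Adj y z ∧ G.dist x z = G.dist x y + 1}) (by omega)
    exact ⟨z, hz⟩

lemma exists_dist_eq_add [Finite V] (h : G.HasProjections n)
    (hdeg : ∀ y, 2 ≤ (G.neighborSet y).ncard) (x y : V) (j : ℕ) (hj : G.dist x y + j ≤ n) :
    ∃ z, G.dist x z = G.dist x y + j ∧ G.dist y z ≤ j := by
  induction j with
  | zero => exact ⟨y, by simp⟩
  | succ j ih =>
    obtain ⟨z, hz, hyz⟩ := ih (by omega)
    obtain ⟨w, hw, hxw⟩ := h.exists_further (x := x) (hdeg z) (by omega)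
    refine ⟨w, by omega, ?_⟩
    rcases h.dist_adj y hw with h1 | h1 <;> omega

/-- Two neighbours of a common vertex have equal degree. -/
lemma ncard_neighborSet_eq_of_adj_adj [Finite V] (h : G.HasProjections n) (hn : 2 ≤ n)
    (hdeg : ∀ y, 3 ≤ (G.neighborSet y).ncard) {x y u : V} (hx : G.Adj u x) (hy : G.Adj u y) :
    (G.neighborSet x).ncard = (G.neighborSet y).ncard := by
  -- A geodesic of length `n - 1` leaving `u` through a third neighbour `v` ends at a vertex `w`
  -- opposite to both `x` and `y`.
  obtain ⟨v, hv, hvxy⟩ : ∃ v ∈ G.neighborSet u, v ∉ ({x, y} : Set V) := by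
    refine Set.exists_mem_notMem_of_ncard_lt_ncard ?_ (Set.toFinite _)
    have : ({x, y} : Set V).ncard ≤ 2 := (Set.ncard_insert_le _ _).trans (by simp)
    have := hdeg u
    omega
  simp only [Set.mem_insert_iff, Set.mem_singleton_iff, not_or] at hvxy
  have huv : G.dist u v = 1 := dist_eq_one_iff_adj.2 hv
  obtain ⟨w, hw, hvw⟩ := h.exists_dist_eq_add (fun y => (hdeg y).trans' (by norm_num)) u v (n - 2)
    (by omega)
  have hwu : G.dist w u = n - 1 := by rw [dist_comm]; omega
  have hwv : G.dist w v < G.dist w u := by rw [dist_comm (v := v)]; omega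
  have key : ∀ z, G.Adj u z → v ≠ z → G.dist z w = n := by
    intro z hz hne
    rw [dist_comm]
    rcases h.dist_adj w hz with h1 | h1
    · omega
    · exact absurd (h.proj_unique w u v z (by omega) hv hz hwv (by omega)) hne
  rw [h.ncard_neighborSet_eq_of_opposite hn (key x hx hvxy.1),
    h.ncard_neighborSet_eq_of_opposite hn (key y hy hvxy.2)]

/-- A closed sequence of period `2(n+1)` without backtracking forces all degrees to be at
least three. -/
lemma three_le_ncard_neighborSet [Finite V] (h : G.HasProjections n) (hn : 2 ≤ n) (v : ℕ → V)
    (hadj : ∀ i, G.Adj (v i) (v (i + 1))) (hne : ∀ i, v i ≠ v (i + 2))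
    (hper : ∀ i, v (i + 2 * (n + 1)) = v i) (x : V) : 3 ≤ (G.neighborSet x).ncard := by
  have hgeo := h.dist_of_nonbacktracking v hadj hne
  -- Both circuit neighbours of `v (i + n + 1)` are opposite `v i`, so its neighbour nearer to `v i`
  -- is a third one.
  have hv : ∀ i, 3 ≤ (G.neighborSet (v (i + n + 1))).ncard := by
    intro i
    have h1 : G.dist (v i) (v (i + n)) = n := hgeo i n le_rfl
    have h2 : G.dist (v i) (v (i + n + 2)) = n := by
      rw [dist_comm, ← hper i]
      have := hgeo (i + n + 2) n le_rfl
      convert this using 3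
      omega
    have h3 := h.dist_of_adj_opposite h1 (hadj (i + n))
    obtain ⟨z, hz, hdz⟩ := h.exists_proj (x := v i) (y := v (i + n + 1)) (by omega)
    have h4 : ({v (i + n), v (i + n + 2), z} : Set V).ncard = 3 := by
      rw [Set.ncard_eq_three]
      refine ⟨_, _, _, hne (i + n), ?_, ?_, rfl⟩ <;> rintro rfl <;> omega
    rw [← h4]
    refine Set.ncard_le_ncard ?_ (Set.toFinite _)
    rintro w (rfl | rfl | rfl)
    · exact (hadj _).symm
    · exact hadj _
    · exact hz
  have hv' : ∀ i, 3 ≤ (G.neighborSet (v i)).ncard := by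
    intro i
    have := hv (i + n + 1)
    rwa [show i + n + 1 + n + 1 = i + 2 * (n + 1) by ring, hper] at this
  -- A vertex of smaller degree is opposite no circuit vertex. Along the circuit its distance, once
  -- increasing, increases forever and reaches `n`; otherwise it decreases forever. Both are
  -- impossible.
  by_contra hx
  have hlt : ∀ i, G.dist x (v i) < n := by
    intro i
    refine lt_of_le_of_ne (h.dist_le _ _) fun he => hx ?_
    rw [h.ncard_neighborSet_eq_of_opposite hn he]
    exact hv' i
  have hgrow : ∀ i, G.dist x (v (i + 1)) = G.dist x (v i) + 1 →
      G.dist x (v (i + 2)) = G.dist x (v (i + 1)) + 1 := by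
    intro i hi
    rcases h.dist_adj x (hadj (i + 1)) with h1 | h1
    · exact h1
    · exact absurd (h.proj_unique x (v (i + 1)) (v i) (v (i + 1 + 1)) (hlt _) (hadj i).symm
        (hadj _) (by omega) (by omega)) (hne i)
  have hall : ∀ i, G.dist x (v (i + 1)) = G.dist x (v i) + 1 →
      ∀ j, G.dist x (v (i + j + 1)) = G.dist x (v (i + j)) + 1 := by
    intro i hi j
    induction j with
    | zero => exact hi
    | succ j ih => exact hgrow _ ih
  by_cases hex : ∃ i, G.dist x (v (i + 1)) = G.dist x (v i) + 1
  · obtain ⟨i, hi⟩ := hex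
    have : ∀ j, G.dist x (v (i + j)) = G.dist x (v i) + j := by
      intro j
      induction j with
      | zero => rfl
      | succ j ih => rw [← add_assoc, hall i hi, ih]; ring
    have h1 := this n
    have := hlt (i + n)
    omega
  · push Not at hex
    have : ∀ j, G.dist x (v j) + j = G.dist x (v 0) := by
      intro j
      induction j with
      | zero => rfl
      | succ j ih =>
        have := (h.dist_adj x (hadj j)).resolve_left (hex j)
        omega
    have h1 := this n
    have := hlt 0
    omega

end HasProjections
end SimpleGraph

/-! ### The incidence graph; its cycles and ordinary polygons. -/

namespace PointLineGeometry

variable {P L : Type*}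

/-- The incidence graph, on points and lines. -/
def incidenceGraph (Γ : PointLineGeometry P L) : SimpleGraph (P ⊕ L) where
  Adj
    | .inl p, .inr l => Γ.Inc p l
    | .inr l, .inl p => Γ.Inc p l
    | _, _ => False
  symm := ⟨by rintro (p | l) (q | m) h <;> exact h⟩
  loopless := ⟨by rintro (p | l) h <;> exact h⟩

variable {Γ : PointLineGeometry P L}

@[simp] lemma incidenceGraph_adj_inl_inr {p : P} {l : L} :
    Γ.incidenceGraph.Adj (.inl p) (.inr l) ↔ Γ.Inc p l := Iff.rfl

@[simp] lemma incidenceGraph_adj_inr_inl {p : P} {l : L} :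
    Γ.incidenceGraph.Adj (.inr l) (.inl p) ↔ Γ.Inc p l := Iff.rfl

@[simp] lemma incidenceGraph_adj_inl_inl {p q : P} :
    ¬ Γ.incidenceGraph.Adj (.inl p) (.inl q) := id

@[simp] lemma incidenceGraph_adj_inr_inr {l m : L} :
    ¬ Γ.incidenceGraph.Adj (.inr l) (.inr m) := id

lemma isLeft_ne_of_adj {x y : P ⊕ L} (h : Γ.incidenceGraph.Adj x y) : x.isLeft ≠ y.isLeft := by
  rcases x with x | x <;> rcases y with y | y <;> simp_all

/-- The bipartition of the incidence graph. -/
def incidenceColoring (Γ : PointLineGeometry P L) : Γ.incidenceGraph.Coloring Bool :=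
  SimpleGraph.Coloring.mk Sum.isLeft isLeft_ne_of_adj

lemma even_length_iff {x y : P ⊕ L} (w : Γ.incidenceGraph.Walk x y) :
    Even w.length ↔ (x.isLeft ↔ y.isLeft) :=
  Γ.incidenceColoring.even_length_iff_congr w

lemma even_dist_iff (hc : Γ.incidenceGraph.Connected) (x y : P ⊕ L) :
    Even (Γ.incidenceGraph.dist x y) ↔ (x.isLeft ↔ y.isLeft) := by
  obtain ⟨w, hw⟩ := hc.exists_walk_length_eq_dist x y
  rw [← hw, even_length_iff]

lemma exists_ordinaryGon_of_isCycle_inl {p : P}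
    (w : Γ.incidenceGraph.Walk (.inl p) (.inl p)) (hw : w.IsCycle) :
    ∃ k, 2 ≤ k ∧ w.length = 2 * k ∧ Nonempty (Γ.OrdinaryGon k) := by
  obtain ⟨k, hk⟩ := ((even_length_iff w).2 Iff.rfl).two_dvd
  have h3 := hw.three_le_length
  have hk2 : 2 ≤ k := by omega
  refine ⟨k, hk2, hk, ?_⟩
  have hpar : ∀ i ≤ w.length, ((w.getVert i).isLeft ↔ Even i) := by
    intro i hi
    induction i with
    | zero => simp
    | succ i ih =>
      have := isLeft_ne_of_adj (w.adj_getVert_succ (i := i) (by omega))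
      have h2 := ih (by omega)
      rw [Nat.even_add_one, ← h2]
      rcases h : (w.getVert i).isLeft <;> rcases h' : (w.getVert (i + 1)).isLeft <;> simp_all
  -- The bound is `i ≤ k` rather than `i < k` because closing the polygon uses `f k = f 0`. Values
  -- outside the range are arbitrary.
  have hpt : ∀ i, ∃ q, i ≤ k → w.getVert (2 * i) = .inl q := by
    intro i
    by_cases hi : i ≤ k
    · obtain ⟨q, hq⟩ := Sum.isLeft_iff.1 ((hpar (2 * i) (by omega)).2 (even_two_mul i))
      exact ⟨q, fun _ => hq⟩
    · exact ⟨p, fun h => absurd h hi⟩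
  choose f hf using hpt
  have hln : ∀ i, i < k → ∃ l, w.getVert (2 * i + 1) = .inr l := by
    intro i hi
    rcases hv : w.getVert (2 * i + 1) with q | l
    · have := (hpar (2 * i + 1) (by omega)).1 (by simp [hv])
      exact absurd this (by simp)
    · exact ⟨l, rfl⟩
  obtain ⟨l₀, -⟩ := hln 0 (by omega)
  have hln' : ∀ i, ∃ l, i < k → w.getVert (2 * i + 1) = .inr l := by
    intro i
    by_cases hi : i < k
    · obtain ⟨l, hl⟩ := hln i hi
      exact ⟨l, fun _ => hl⟩
    · exact ⟨l₀, fun h => absurd h hi⟩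
  choose g hg using hln'
  have : NeZero k := ⟨by omega⟩
  have : Fact (1 < k) := ⟨by omega⟩
  have hlt : ∀ i : ZMod k, i.val < k := fun i => ZMod.val_lt i
  have hinj := hw.getVert_injOn'
  have hfk : f k = f 0 := by
    have h1 := hf k le_rfl
    have h2 := hf 0 (by omega)
    rw [← hk, w.getVert_length] at h1
    rw [Nat.mul_zero, w.getVert_zero, h1] at h2
    exact Sum.inl.inj h2
  refine ⟨⟨fun i => f i.val, fun i => g i.val, ?_, ?_, ?_, ?_⟩⟩
  · intro i j hij
    have h1 := hf i.val (hlt i).le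
    have h2 := hf j.val (hlt j).le
    have hi := hlt i
    have hj := hlt j
    have := hinj (x₁ := 2 * i.val) (x₂ := 2 * j.val)
      (by simp only [Set.mem_ofPred_eq]; omega) (by simp only [Set.mem_ofPred_eq]; omega)
      (by rw [h1, h2]; exact congrArg _ hij)
    exact ZMod.val_injective k (by omega)
  · intro i j hij
    have h1 := hg i.val (hlt i)
    have h2 := hg j.val (hlt j)
    have hi := hlt i
    have hj := hlt j
    have := hinj (x₁ := 2 * i.val + 1) (x₂ := 2 * j.val + 1)
      (by simp only [Set.mem_ofPred_eq]; omega) (by simp only [Set.mem_ofPred_eq]; omega)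
      (by rw [h1, h2]; exact congrArg _ hij)
    exact ZMod.val_injective k (by omega)
  · intro i
    have h := w.adj_getVert_succ (i := 2 * i.val) (by have := hlt i; omega)
    rwa [hf _ (hlt i).le, hg _ (hlt i)] at h
  · intro i
    have h := w.adj_getVert_succ (i := 2 * i.val + 1) (by have := hlt i; omega)
    rw [hg _ (hlt i), show 2 * i.val + 1 + 1 = 2 * (i.val + 1) by ring, hf _ (hlt i)] at h
    have : f (i + 1).val = f (i.val + 1) := by
      rw [ZMod.val_add, ZMod.val_one]
      rcases Nat.lt_or_ge (i.val + 1) k with h1 | h1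
      · rw [Nat.mod_eq_of_lt h1]
      · have h2 : i.val + 1 = k := le_antisymm (hlt i) h1
        rw [h2, Nat.mod_self, hfk]
    change Γ.Inc (f (i + 1).val) (g i.val)
    rw [this]
    exact h

lemma exists_ordinaryGon_of_isCycle {x : P ⊕ L} (w : Γ.incidenceGraph.Walk x x)
    (hw : w.IsCycle) : ∃ k, 2 ≤ k ∧ w.length = 2 * k ∧ Nonempty (Γ.OrdinaryGon k) := by
  classical
  rcases x with p | l
  · exact exists_ordinaryGon_of_isCycle_inl w hw
  · rcases hs : w.snd with q | m
    · have hmem : Sum.inl q ∈ w.support := hs ▸ w.getVert_mem_support 1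
      have := exists_ordinaryGon_of_isCycle_inl (w.rotate _ hmem) (hw.rotate hmem)
      simpa using this
    · have := w.adj_snd hw.not_nil
      rw [hs] at this
      exact this.elim

namespace OrdinaryGon

variable {k : ℕ}

/-- The vertices of an ordinary `k`-gon in cyclic order, alternating points and lines. -/
def vertex (c : Γ.OrdinaryGon k) (i : ℕ) : P ⊕ L :=
  if Even i then .inl (c.point (i / 2 : ℕ)) else .inr (c.line (i / 2 : ℕ))

lemma vertex_two_mul (c : Γ.OrdinaryGon k) (i : ℕ) : c.vertex (2 * i) = .inl (c.point i) := by
  simp [vertex]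

lemma vertex_two_mul_add_one (c : Γ.OrdinaryGon k) (i : ℕ) :
    c.vertex (2 * i + 1) = .inr (c.line i) := by
  have : (2 * i + 1) / 2 = i := by omega
  simp [vertex, this]

lemma adj_vertex (c : Γ.OrdinaryGon k) (i : ℕ) :
    Γ.incidenceGraph.Adj (c.vertex i) (c.vertex (i + 1)) := by
  obtain ⟨j, rfl | rfl⟩ := Nat.even_or_odd' i
  · rw [vertex_two_mul, vertex_two_mul_add_one]
    exact c.inc_left j
  · rw [show 2 * j + 1 + 1 = 2 * (j + 1) by ring, vertex_two_mul, vertex_two_mul_add_one]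
    have := c.inc_right j
    rwa [← Nat.cast_add_one] at this

lemma vertex_ne (c : Γ.OrdinaryGon k) (hk : 2 ≤ k) (i : ℕ) : c.vertex i ≠ c.vertex (i + 2) := by
  have : Fact (1 < k) := ⟨hk⟩
  have hne : ∀ j : ℕ, (j : ZMod k) ≠ ((j + 1 : ℕ) : ZMod k) := by
    intro j h
    push_cast at h
    exact one_ne_zero (left_eq_add.1 h)
  obtain ⟨j, rfl | rfl⟩ := Nat.even_or_odd' i
  · rw [show 2 * j + 2 = 2 * (j + 1) by ring, vertex_two_mul, vertex_two_mul]
    exact fun h => hne j (c.point_injective (Sum.inl.inj h))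
  · rw [show 2 * j + 1 + 2 = 2 * (j + 1) + 1 by ring, vertex_two_mul_add_one,
      vertex_two_mul_add_one]
    exact fun h => hne j (c.line_injective (Sum.inr.inj h))

lemma vertex_add_period (c : Γ.OrdinaryGon k) (i : ℕ) : c.vertex (i + 2 * k) = c.vertex i := by
  obtain ⟨j, rfl | rfl⟩ := Nat.even_or_odd' i
  · rw [show 2 * j + 2 * k = 2 * (j + k) by ring, vertex_two_mul, vertex_two_mul]
    simp
  · rw [show 2 * j + 1 + 2 * k = 2 * (j + k) + 1 by ring, vertex_two_mul_add_one,
      vertex_two_mul_add_one]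
    simp

lemma exists_vertex_eq (c : Γ.OrdinaryGon k) (hk : 0 < k) {x : P ⊕ L} (hx : x ∈ c.elements) :
    ∃ i < 2 * k, c.vertex i = x := by
  have : NeZero k := ⟨hk.ne'⟩
  rcases hx with ⟨i, rfl⟩ | ⟨i, rfl⟩
  · have := ZMod.val_lt i
    exact ⟨2 * i.val, by omega, by rw [vertex_two_mul]; simp⟩
  · have := ZMod.val_lt i
    exact ⟨2 * i.val + 1, by omega, by rw [vertex_two_mul_add_one]; simp⟩

lemma exists_walk_vertex (c : Γ.OrdinaryGon k) (i j : ℕ) :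
    ∃ w : Γ.incidenceGraph.Walk (c.vertex i) (c.vertex (i + j)), w.length = j := by
  induction j with
  | zero => exact ⟨.nil, rfl⟩
  | succ j ih =>
    obtain ⟨w, hw⟩ := ih
    exact ⟨w.concat (c.adj_vertex (i + j)), by simp [hw]⟩

lemma exists_walk_length_le (c : Γ.OrdinaryGon k) (hk : 0 < k) {x y : P ⊕ L}
    (hx : x ∈ c.elements) (hy : y ∈ c.elements) :
    ∃ w : Γ.incidenceGraph.Walk x y, w.length ≤ k := by
  obtain ⟨i, hi, rfl⟩ := c.exists_vertex_eq hk hx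
  obtain ⟨j, hj, rfl⟩ := c.exists_vertex_eq hk hy
  have key : ∀ i j, i ≤ j → j < 2 * k →
      ∃ w : Γ.incidenceGraph.Walk (c.vertex i) (c.vertex j), w.length ≤ k := by
    intro i j hij hj
    rcases Nat.le_total (j - i) k with h | h
    · have := c.exists_walk_vertex i (j - i)
      rw [Nat.add_sub_cancel' hij] at this
      obtain ⟨w, hw⟩ := this
      exact ⟨w, hw ▸ h⟩
    · have := c.exists_walk_vertex j (i + 2 * k - j)
      rw [Nat.add_sub_cancel' (by omega), vertex_add_period] at this
      obtain ⟨w, hw⟩ := this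
      exact ⟨w.reverse, by rw [SimpleGraph.Walk.length_reverse]; omega⟩
  rcases Nat.le_total i j with h | h
  · exact key i j h hj
  · obtain ⟨w, hw⟩ := key j i h hi
    exact ⟨w.reverse, by simpa using hw⟩

end OrdinaryGon

/-! ### Projections and the order of a generalized polygon. -/

namespace IsGeneralizedPolygon

variable {n : ℕ}

lemma hasProjections (h : Γ.IsGeneralizedPolygon n) : Γ.incidenceGraph.HasProjections n := by
  have h3 := h.three_le
  have hwalk : ∀ x y, ∃ w : Γ.incidenceGraph.Walk x y, w.length ≤ n := by
    intro x y
    obtain ⟨c, hx, hy⟩ := h.exists_gon x y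
    exact c.exists_walk_length_le (by omega) hx hy
  have hconn : Γ.incidenceGraph.Connected := by
    obtain ⟨c⟩ := h.thick
    have : Nonempty (P ⊕ L) := ⟨.inl (c.point 0)⟩
    exact ⟨fun x y => ⟨(hwalk x y).choose⟩⟩
  refine ⟨hconn, fun x y => ?_, fun x y z hyz he => ?_, fun x y z z' hn hz hz' hd hd' => ?_⟩
  · obtain ⟨w, hw⟩ := hwalk x y
    exact (SimpleGraph.dist_le w).trans hw
  · have h1 := even_dist_iff hconn x y
    have h2 := even_dist_iff hconn x z
    rw [he, h2] at h1
    have := isLeft_ne_of_adj hyz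
    rcases hx : x.isLeft <;> rcases hy : y.isLeft <;> rcases hz : z.isLeft <;> simp_all
  -- Two nearer neighbours would give distinct geodesics of length less than `n` with the same ends,
  -- hence a cycle of length less than `2 * n`, a forbidden polygon.
  · have key : ∀ z, Γ.incidenceGraph.Adj y z →
        Γ.incidenceGraph.dist x z < Γ.incidenceGraph.dist x y →
        ∃ p : Γ.incidenceGraph.Walk y x, p.IsPath ∧ p.length = Γ.incidenceGraph.dist x y ∧
          p.snd = z := by
      intro z hz hd
      obtain ⟨q, hq⟩ := hconn.exists_walk_length_eq_dist z x
      have hq' := hq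
      rw [SimpleGraph.dist_comm] at hq'
      have hlen : (SimpleGraph.Walk.cons hz q).length = Γ.incidenceGraph.dist x y := by
        have := SimpleGraph.dist_le (SimpleGraph.Walk.cons hz q)
        rw [SimpleGraph.dist_comm] at this
        rw [SimpleGraph.Walk.length_cons] at *
        omega
      refine ⟨.cons hz q, SimpleGraph.Walk.isPath_of_length_eq_dist _ ?_, hlen, by simp⟩
      rw [hlen, SimpleGraph.dist_comm]
    obtain ⟨p, hp, hpl, rfl⟩ := key z hz hd
    obtain ⟨q, hq, hql, rfl⟩ := key z' hz' hd'
    by_contra hne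
    have hpq : p ≠ q := fun h => hne (by rw [h])
    obtain ⟨w, -, -, c, hc, hcl⟩ := hp.exists_isCycle_length_le_add_of_ne hq hpq
    obtain ⟨k, hk2, hk, ⟨g⟩⟩ := exists_ordinaryGon_of_isCycle c hc
    exact (h.no_small_gon k hk2 (by omega)).false g

lemma three_le_ncard_neighborSet [Finite P] [Finite L] (h : Γ.IsGeneralizedPolygon n)
    (x : P ⊕ L) : 3 ≤ (Γ.incidenceGraph.neighborSet x).ncard := by
  obtain ⟨c⟩ := h.thick
  have h3 := h.three_le
  exact h.hasProjections.three_le_ncard_neighborSet (by omega) c.vertex c.adj_vertex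
    (c.vertex_ne (by omega)) c.vertex_add_period x

lemma ncard_neighborSet_eq [Finite P] [Finite L] (h : Γ.IsGeneralizedPolygon n)
    {x y : P ⊕ L} (hxy : x.isLeft ↔ y.isLeft) :
    (Γ.incidenceGraph.neighborSet x).ncard = (Γ.incidenceGraph.neighborSet y).ncard := by
  have h3 := h.three_le
  have hG := h.hasProjections
  obtain ⟨j, hj⟩ := ((even_dist_iff hG.connected x y).2 hxy).two_dvd
  induction j generalizing y with
  | zero =>
    rw [(hG.connected.dist_eq_zero_iff).1 hj]
  | succ j ih =>
    obtain ⟨u, hu, hdu⟩ := hG.exists_proj (x := x) (y := y) (by omega)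
    obtain ⟨z, hz, hdz⟩ := hG.exists_proj (x := x) (y := u) (by omega)
    have hz2 : Γ.incidenceGraph.dist x z = 2 * j := by omega
    rw [ih ((even_dist_iff hG.connected x z).1 (hz2 ▸ even_two_mul j)) hz2]
    exact hG.ncard_neighborSet_eq_of_adj_adj (by omega) h.three_le_ncard_neighborSet hz hu.symm

end IsGeneralizedPolygon

lemma neighborSet_inl (p : P) :
    Γ.incidenceGraph.neighborSet (.inl p) = Sum.inr '' {l | Γ.Inc p l} := by
  ext (q | l) <;> simp

lemma neighborSet_inr (l : L) :
    Γ.incidenceGraph.neighborSet (.inr l) = Sum.inl '' {p | Γ.Inc p l} := by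
  ext (q | m) <;> simp

lemma ncard_neighborSet_inl (p : P) :
    (Γ.incidenceGraph.neighborSet (.inl p)).ncard = {l | Γ.Inc p l}.ncard := by
  rw [neighborSet_inl, Set.ncard_image_of_injective _ Sum.inr_injective]

lemma ncard_neighborSet_inr (l : L) :
    (Γ.incidenceGraph.neighborSet (.inr l)).ncard = {p | Γ.Inc p l}.ncard := by
  rw [neighborSet_inr, Set.ncard_image_of_injective _ Sum.inl_injective]

namespace IsGeneralizedPolygon

variable {n : ℕ}

lemma exists_hasOrder [Finite P] [Finite L] (h : Γ.IsGeneralizedPolygon n) :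
    ∃ s t, Γ.HasOrder s t := by
  obtain ⟨c⟩ := h.thick
  have h1 := h.three_le_ncard_neighborSet (.inl (c.point 0))
  have h2 := h.three_le_ncard_neighborSet (.inr (c.line 0))
  refine ⟨(Γ.incidenceGraph.neighborSet (.inr (c.line 0))).ncard - 1,
    (Γ.incidenceGraph.neighborSet (.inl (c.point 0))).ncard - 1, by omega, by omega,
    fun p => ?_, fun l => ?_⟩
  · rw [← ncard_neighborSet_inl, h.ncard_neighborSet_eq (y := .inl (c.point 0)) (by simp)]
    omega
  · rw [← ncard_neighborSet_inr, h.ncard_neighborSet_eq (y := .inr (c.line 0)) (by simp)]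
    omega

lemma exists_dist_eq [Finite P] [Finite L] (h : Γ.IsGeneralizedPolygon n) (x : P ⊕ L) {j : ℕ}
    (hj : j ≤ n) : ∃ y, Γ.incidenceGraph.dist x y = j := by
  obtain ⟨z, hz, -⟩ := h.hasProjections.exists_dist_eq_add
    (fun y => (h.three_le_ncard_neighborSet y).trans' (by norm_num)) x x j (by simpa using hj)
  exact ⟨z, by simpa using hz⟩

/-- For odd `n` the elements opposite a point are lines, and opposite elements have equal degree. -/
lemma order_eq_of_odd [Finite P] [Finite L] (h : Γ.IsGeneralizedPolygon n) (hn : Odd n)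
    {s t : ℕ} (ho : Γ.HasOrder s t) : s = t := by
  obtain ⟨c⟩ := h.thick
  have h3 := h.three_le
  obtain ⟨y, hy⟩ := h.exists_dist_eq (.inl (c.point 0)) le_rfl
  have h1 := even_dist_iff h.hasProjections.connected (.inl (c.point 0)) y
  rw [hy, ← Nat.not_odd_iff_even] at h1
  rcases y with p | l
  · simp [hn] at h1
  · have h2 := h.hasProjections.ncard_neighborSet_eq_of_opposite (by omega) hy
    rw [ncard_neighborSet_inl, ncard_neighborSet_inr, ho.lines_through, ho.points_on] at h2
    omega

end IsGeneralizedPolygon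
end PointLineGeometry

/-! ### Distance matrices and their products with the incidence matrix. -/

namespace SimpleGraph.HasProjections

variable {V : Type*} {G : SimpleGraph V} {n : ℕ}

open Classical in
/-- The number of neighbours of `y` at distance `j ≥ 2` from `x`. -/
lemma ncard_adj_dist_eq [Finite V] (h : G.HasProjections n) (x y : V) {j : ℕ} (hj : 2 ≤ j)
    (hjn : j < n) :
    ({z | G.Adj y z ∧ G.dist x z = j}.ncard : ℝ) =
      (if j + 1 = n then ((G.neighborSet y).ncard : ℝ) else 1) *
          (if G.dist x y = j + 1 then 1 else 0) +
        ((G.neighborSet y).ncard - 1) * (if G.dist x y = j - 1 then 1 else 0) := by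
  -- The assumption `2 ≤ j` keeps `y ≠ x` in the second term; for `y = x` all neighbours, not all
  -- but one, are at distance `1`.
  have hle := h.dist_le x y
  by_cases h1 : G.dist x y = j + 1
  · rw [if_pos h1, if_neg (c := G.dist x y = j - 1) (by omega), mul_zero, add_zero, mul_one]
    split_ifs with h2
    · congr 2
      ext z
      simp only [Set.mem_ofPred_eq, mem_neighborSet, and_iff_left_iff_imp]
      intro hz
      have := h.dist_of_adj_opposite (h1.trans h2) hz
      omega
    · have := h.ncard_closer (x := x) (y := y) (by omega) (by omega)
      rw [h1] at this
      simpa using this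
  · rw [if_neg h1, mul_zero, zero_add]
    by_cases h2 : G.dist x y = j - 1
    · rw [if_pos h2, mul_one, ← h.ncard_further (x := x) (y := y) (by omega) (by omega), h2,
        Nat.sub_add_cancel (by omega)]
      simp
    · rw [if_neg h2, mul_zero, Nat.cast_eq_zero, Set.ncard_eq_zero, Set.eq_empty_iff_forall_notMem]
      rintro z ⟨hz, hd⟩
      rcases h.dist_adj x hz with h3 | h3 <;> omega

end SimpleGraph.HasProjections

namespace PointLineGeometry

variable {P L : Type*}

lemma sum_ite_mul_ite_eq_ncard {α : Type*} [Fintype α] (p q : α → Prop) [DecidablePred p]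
    [DecidablePred q] :
    ∑ y, ((if p y then 1 else 0) * (if q y then 1 else 0) : ℝ) = ({y | q y ∧ p y}.ncard : ℝ) := by
  rw [Set.ncard_eq_toFinset_card' {y | q y ∧ p y}, Set.toFinset_ofPred, ← Finset.sum_boole]
  simp only [ite_zero_mul_ite_zero, mul_one, and_comm]

open Classical in
/-- The matrix of pairs of points at distance `2 * i` in the incidence graph. -/
noncomputable def pointDistMatrix (Γ : PointLineGeometry P L) (i : ℕ) : Matrix P P ℝ :=
  Matrix.of fun x y => if Γ.incidenceGraph.dist (.inl x) (.inl y) = 2 * i then 1 else 0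

open Classical in
/-- The matrix of pairs of a point and a line at distance `2 * i + 1` in the incidence graph. -/
noncomputable def flagDistMatrix (Γ : PointLineGeometry P L) (i : ℕ) : Matrix P L ℝ :=
  Matrix.of fun x l => if Γ.incidenceGraph.dist (.inl x) (.inr l) = 2 * i + 1 then 1 else 0

open Classical in
/-- The incidence matrix. -/
noncomputable def incMatrix (Γ : PointLineGeometry P L) : Matrix P L ℝ :=
  Matrix.of fun x l => if Γ.Inc x l then 1 else 0

variable {Γ : PointLineGeometry P L} {n s t : ℕ}

open Classical in
lemma flagDistMatrix_zero : Γ.flagDistMatrix 0 = Γ.incMatrix := by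
  ext x l
  simp only [flagDistMatrix, incMatrix, Matrix.of_apply, mul_zero, zero_add,
    SimpleGraph.dist_eq_one_iff_adj, incidenceGraph_adj_inl_inr]

namespace IsGeneralizedPolygon

lemma pointDistMatrix_zero [DecidableEq P] (h : Γ.IsGeneralizedPolygon n) :
    Γ.pointDistMatrix 0 = 1 := by
  ext x y
  simp [pointDistMatrix, h.hasProjections.connected.dist_eq_zero_iff, Matrix.one_apply]

lemma dist_inl_inl_eq_two_iff (h : Γ.IsGeneralizedPolygon n) {x y : P} :
    Γ.incidenceGraph.dist (.inl x) (.inl y) = 2 ↔ Γ.pointGraph.Adj x y := by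
  have hG := h.hasProjections
  constructor
  · intro hd
    obtain ⟨z, hz, hdz⟩ := hG.exists_proj (x := .inl x) (y := .inl y) (by omega)
    have hxz : Γ.incidenceGraph.dist (.inl x) z = 1 := by omega
    rw [SimpleGraph.dist_eq_one_iff_adj] at hxz
    rcases z with p | l
    · exact hxz.elim
    · refine ⟨?_, l, hxz, hz⟩
      rintro rfl
      simp at hd
  · rintro ⟨hne, l, hx, hy⟩
    have h1 : Γ.incidenceGraph.dist (.inl x) (.inr l) = 1 := SimpleGraph.dist_eq_one_iff_adj.2 hx
    rcases hG.dist_adj (.inl x) (y := .inr l) (z := .inl y) hy with h2 | h2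
    · omega
    · have h3 : Γ.incidenceGraph.dist (.inl x) (.inl y) = 0 := by omega
      exact absurd (Sum.inl.inj (hG.connected.dist_eq_zero_iff.1 h3)) hne

lemma pointDistMatrix_one (h : Γ.IsGeneralizedPolygon n) :
    Γ.pointDistMatrix 1 = Γ.collinearityMatrix := by
  ext x y
  simp only [pointDistMatrix, collinearityMatrix, Matrix.of_apply, SimpleGraph.adjMatrix_apply]
  classical
  exact if_congr h.dist_inl_inl_eq_two_iff rfl rfl

lemma subsingleton_common_line (h : Γ.IsGeneralizedPolygon n) {x y : P} (hne : x ≠ y) :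
    {l | Γ.Inc y l ∧ Γ.Inc x l}.Subsingleton := by
  rintro l ⟨hy, hx⟩ m ⟨hy', hx'⟩
  have hd := h.dist_inl_inl_eq_two_iff.2 ⟨hne, l, hx, hy⟩
  have h3 := h.three_le
  have h1 : Γ.incidenceGraph.dist (.inl x) (.inr l) = 1 := SimpleGraph.dist_eq_one_iff_adj.2 hx
  have h2 : Γ.incidenceGraph.dist (.inl x) (.inr m) = 1 := SimpleGraph.dist_eq_one_iff_adj.2 hx'
  exact Sum.inr.inj (h.hasProjections.proj_unique (.inl x) (.inl y) (.inr l) (.inr m) (by omega)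
    hy hy' (by omega) (by omega))

lemma incMatrix_mul_transpose [DecidableEq P] [Fintype L] (h : Γ.IsGeneralizedPolygon n)
    (ho : Γ.HasOrder s t) :
    Γ.incMatrix * Γ.incMatrix.transpose = Γ.collinearityMatrix + (t + 1 : ℝ) • 1 := by
  classical
  ext x y
  simp only [Matrix.mul_apply, incMatrix, Matrix.of_apply, Matrix.transpose_apply,
    sum_ite_mul_ite_eq_ncard, collinearityMatrix, Matrix.add_apply, Matrix.smul_apply,
    SimpleGraph.adjMatrix_apply, smul_eq_mul]
  rcases eq_or_ne x y with rfl | hne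
  · simp [ho.lines_through]
  · rw [Matrix.one_apply_ne hne, mul_zero, add_zero]
    split_ifs with hadj
    · obtain ⟨-, l, hx, hy⟩ := hadj
      rw [(h.subsingleton_common_line hne).eq_singleton_of_mem (x := l) ⟨hy, hx⟩]
      simp
    · rw [Nat.cast_eq_zero, Set.ncard_eq_zero, Set.eq_empty_iff_forall_notMem]
      rintro l ⟨hy, hx⟩
      exact hadj ⟨hne, l, hx, hy⟩

/-- The strict bound excludes lines opposite `x`, on which all `s + 1` points, not one, would be
counted. -/
lemma pointDistMatrix_mul_incMatrix [Fintype P] [Finite L] (h : Γ.IsGeneralizedPolygon n)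
    (ho : Γ.HasOrder s t) {i : ℕ} (hi : 2 * (i + 1) + 1 < n) :
    Γ.pointDistMatrix (i + 1) * Γ.incMatrix =
      Γ.flagDistMatrix (i + 1) + (s : ℝ) • Γ.flagDistMatrix i := by
  classical
  ext x l
  have h1 := h.hasProjections.ncard_adj_dist_eq (.inl x) (.inr l) (j := 2 * (i + 1)) (by omega)
    (by omega)
  have h2 : {z | Γ.incidenceGraph.Adj (.inr l) z ∧
      Γ.incidenceGraph.dist (.inl x) z = 2 * (i + 1)} =
      Sum.inl '' {y | Γ.Inc y l ∧ Γ.incidenceGraph.dist (.inl x) (.inl y) = 2 * (i + 1)} := by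
    ext (q | m) <;> simp
  rw [h2, Set.ncard_image_of_injective _ Sum.inl_injective, ncard_neighborSet_inr, ho.points_on,
    if_neg hi.ne, one_mul] at h1
  simp only [Matrix.mul_apply, pointDistMatrix, incMatrix, Matrix.of_apply,
    sum_ite_mul_ite_eq_ncard, flagDistMatrix, Matrix.add_apply, Matrix.smul_apply, smul_eq_mul]
  rw [h1, show 2 * (i + 1) - 1 = 2 * i + 1 by omega]
  push_cast
  ring

lemma flagDistMatrix_mul_transpose [Finite P] [Fintype L] (h : Γ.IsGeneralizedPolygon n)
    (ho : Γ.HasOrder s t) {i : ℕ} (hi : 2 * (i + 2) ≤ n) :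
    Γ.flagDistMatrix (i + 1) * Γ.incMatrix.transpose =
      (if 2 * (i + 2) = n then (t + 1 : ℝ) else 1) • Γ.pointDistMatrix (i + 2) +
        (t : ℝ) • Γ.pointDistMatrix (i + 1) := by
  classical
  ext x y
  have h1 := h.hasProjections.ncard_adj_dist_eq (.inl x) (.inl y) (j := 2 * (i + 1) + 1) (by omega)
    (by omega)
  have h2 : {z | Γ.incidenceGraph.Adj (.inl y) z ∧
      Γ.incidenceGraph.dist (.inl x) z = 2 * (i + 1) + 1} =
      Sum.inr '' {l | Γ.Inc y l ∧ Γ.incidenceGraph.dist (.inl x) (.inr l) = 2 * (i + 1) + 1} := by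
    ext (q | m) <;> simp
  rw [h2, Set.ncard_image_of_injective _ Sum.inr_injective, ncard_neighborSet_inl,
    ho.lines_through] at h1
  simp only [Matrix.mul_apply, pointDistMatrix, incMatrix, Matrix.of_apply, Matrix.transpose_apply,
    sum_ite_mul_ite_eq_ncard, flagDistMatrix, Matrix.add_apply, Matrix.smul_apply, smul_eq_mul]
  rw [h1, show 2 * (i + 1) + 1 - 1 = 2 * (i + 1) by omega,
    show 2 * (i + 1) + 1 + 1 = 2 * (i + 2) by ring]
  push_cast
  ring

end IsGeneralizedPolygon

/-! ### Distance matrices as polynomials in the collinearity matrix. -/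

open Polynomial

/-- The polynomials expressing the distance matrices of the point graph of a generalized polygon
of order `(s, t)` in terms of its collinearity matrix. -/
noncomputable def distPoly {R : Type*} [CommRing R] (s t : R) : ℕ → R[X]
  | 0 => 1
  | 1 => X
  -- Here `s * (t + 1)` replaces `s * t`: all `t + 1` lines on the base point lead away from it.
  | 2 => X * (X + C (1 - s)) - C (s * (t + 1))
  | i + 3 => distPoly s t (i + 2) * (X + C (1 - s)) - C (s * t) * distPoly s t (i + 1)

namespace IsGeneralizedPolygon

lemma pointDistMatrix_one_mul [Fintype P] [DecidableEq P] [Finite L]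
    (h : Γ.IsGeneralizedPolygon n) (ho : Γ.HasOrder s t) (hn : 4 ≤ n) :
    Γ.pointDistMatrix 1 * (Γ.collinearityMatrix + (1 - s : ℝ) • 1) =
      (if 4 = n then (t + 1 : ℝ) else 1) • Γ.pointDistMatrix 2 + (s * (t + 1) : ℝ) • 1 := by
  classical
  cases nonempty_fintype L
  have hM := h.incMatrix_mul_transpose ho
  have h1 := h.pointDistMatrix_mul_incMatrix ho (i := 0) (by omega)
  have h2 := h.flagDistMatrix_mul_transpose ho (i := 0) (by omega)
  have h3 : Γ.pointDistMatrix 1 * (Γ.incMatrix * Γ.incMatrix.transpose) =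
      Γ.flagDistMatrix 1 * Γ.incMatrix.transpose +
        (s : ℝ) • (Γ.incMatrix * Γ.incMatrix.transpose) := by
    rw [← Matrix.mul_assoc, ← zero_add 1, h1, flagDistMatrix_zero, Matrix.add_mul, Matrix.smul_mul]
  rw [h2, hM, h.pointDistMatrix_one] at h3
  rw [h.pointDistMatrix_one]
  simp only [Matrix.mul_add, Matrix.mul_smul, Matrix.mul_one, zero_add] at h3 ⊢
  rw [← sub_eq_zero] at h3 ⊢
  rw [← h3]
  module

lemma pointDistMatrix_mul [Fintype P] [DecidableEq P] [Finite L]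
    (h : Γ.IsGeneralizedPolygon n) (ho : Γ.HasOrder s t) {i : ℕ} (hi : 2 * (i + 3) ≤ n) :
    Γ.pointDistMatrix (i + 2) * (Γ.collinearityMatrix + (1 - s : ℝ) • 1) =
      (if 2 * (i + 3) = n then (t + 1 : ℝ) else 1) • Γ.pointDistMatrix (i + 3) +
        (s * t : ℝ) • Γ.pointDistMatrix (i + 1) := by
  classical
  cases nonempty_fintype L
  have hM := h.incMatrix_mul_transpose ho
  have h1 := h.pointDistMatrix_mul_incMatrix ho (i := i + 1) (by omega)
  have h2 := h.flagDistMatrix_mul_transpose ho (i := i + 1) (by omega)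
  have h2' := h.flagDistMatrix_mul_transpose ho (i := i) (by omega)
  have h3 : Γ.pointDistMatrix (i + 2) * (Γ.incMatrix * Γ.incMatrix.transpose) =
      Γ.flagDistMatrix (i + 2) * Γ.incMatrix.transpose +
        (s : ℝ) • (Γ.flagDistMatrix (i + 1) * Γ.incMatrix.transpose) := by
    rw [← Matrix.mul_assoc, h1, Matrix.add_mul, Matrix.smul_mul]
  rw [if_neg (by omega)] at h2'
  rw [h2, h2', hM] at h3
  simp only [Matrix.mul_add, Matrix.mul_smul, Matrix.mul_one] at h3 ⊢
  rw [← sub_eq_zero] at h3 ⊢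
  rw [← h3]
  module

/-- The factor `t + 1` appears when `2 * i = n` because every line on an opposite point is nearer to
the base point. It never enters the recurrence, which only uses smaller indices. -/
theorem aeval_distPoly [Fintype P] [DecidableEq P] [Finite L]
    (h : Γ.IsGeneralizedPolygon n) (ho : Γ.HasOrder s t) {i : ℕ} (hi : 2 * i ≤ n) :
    aeval Γ.collinearityMatrix (distPoly (s : ℝ) (t : ℝ) i) =
      (if 2 * i = n then (t + 1 : ℝ) else 1) • Γ.pointDistMatrix i := by
  have h3 := h.three_le
  have hC : ∀ r : ℝ, aeval Γ.collinearityMatrix (C r) = r • 1 := fun r => by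
    rw [aeval_C, Algebra.algebraMap_eq_smul_one]
  induction i using Nat.strong_induction_on with
  | _ i ih =>
    match i with
    | 0 => rw [if_neg (by omega), distPoly, h.pointDistMatrix_zero, map_one, one_smul]
    | 1 => rw [if_neg (by omega), distPoly, h.pointDistMatrix_one, aeval_X, one_smul]
    | 2 =>
      have := h.pointDistMatrix_one_mul ho hi
      rw [h.pointDistMatrix_one] at this
      rw [distPoly, map_sub, map_mul, map_add, aeval_X, hC, hC, this, add_sub_cancel_right]
    | i + 3 =>
      have h1 := ih (i + 1) (by omega) (by omega)
      have h2 := ih (i + 2) (by omega) (by omega)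
      rw [if_neg (by omega), one_smul] at h1 h2
      rw [distPoly, map_sub, map_mul, map_mul, map_add, aeval_X, hC, hC, h1, h2,
        h.pointDistMatrix_mul ho hi, smul_mul_assoc, one_mul, add_sub_cancel_right]

end IsGeneralizedPolygon
end PointLineGeometry

/-! ### Eigenvalue multiplicities of symmetric matrices from traces. -/

namespace Polynomial

lemma eval_prod_X_sub_C_erase_ne_zero (T : Finset ℝ) (μ : ℝ) :
    (∏ x ∈ T.erase μ, (X - C x) : ℝ[X]).eval μ ≠ 0 := by
  simp only [eval_prod, eval_sub, eval_X, eval_C]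
  exact Finset.prod_ne_zero_iff.2 fun x hx => sub_ne_zero.2 (Finset.ne_of_mem_erase hx).symm

/-- The product vanishes at every value of `f` other than `μ`, so the sum isolates the multiplicity
of `μ`. The coercion `RCLike.ofReal` matches the form of `roots_charpoly_eq_eigenvalues`. -/
lemma sum_eval_prod_X_sub_C_erase {σ : Type*} [Fintype σ] (T : Finset ℝ) (μ : ℝ) (f : σ → ℝ)
    (hf : ∀ i, f i ∈ T) :
    ∑ i, (∏ x ∈ T.erase μ, (X - C x) : ℝ[X]).eval (f i) =
      ((Finset.univ.val.map (RCLike.ofReal ∘ f)).count μ : ℝ) *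
        (∏ x ∈ T.erase μ, (X - C x) : ℝ[X]).eval μ := by
  rw [Multiset.count_map, ← Finset.filter_val, Finset.card_val, ← nsmul_eq_mul,
    ← Finset.sum_const, Finset.sum_filter]
  refine Finset.sum_congr rfl fun i _ => ?_
  by_cases hi : f i = μ
  · simp [hi]
  · rw [if_neg (by simpa using Ne.symm hi)]
    simp only [eval_prod, eval_sub, eval_X, eval_C]
    exact Finset.prod_eq_zero (Finset.mem_erase.2 ⟨hi, hf i⟩) (sub_self _)

end Polynomial

namespace Matrix.IsHermitian

open Polynomial

variable {ι κ : Type*} [Fintype ι] [DecidableEq ι] [Fintype κ] [DecidableEq κ]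
  {A : Matrix ι ι ℝ} {B : Matrix κ κ ℝ}

lemma aeval_eq_conj_diagonal (hA : A.IsHermitian) (r : ℝ[X]) :
    aeval A r = Unitary.conjStarAlgAut ℝ _ hA.eigenvectorUnitary
      (diagonal fun i => r.eval (hA.eigenvalues i)) := by
  conv_lhs => rw [hA.spectral_theorem]
  have h1 := aeval_algHom_apply
    (Unitary.conjStarAlgAut ℝ (Matrix ι ι ℝ) hA.eigenvectorUnitary).toAlgEquiv.toAlgHom
    (diagonal (RCLike.ofReal ∘ hA.eigenvalues)) r
  refine h1.trans ?_
  have h2 := aeval_algHom_apply (diagonalAlgHom (n := ι) (α := ℝ) ℝ)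
    (RCLike.ofReal ∘ hA.eigenvalues) r
  change aeval (diagonal (RCLike.ofReal ∘ hA.eigenvalues)) r = diagonal _ at h2
  rw [h2]
  change Unitary.conjStarAlgAut ℝ _ hA.eigenvectorUnitary _ = _
  congr 2
  ext i
  rw [aeval_pi_apply₂]
  simp [coe_aeval_eq_eval]

lemma trace_aeval_eq_sum (hA : A.IsHermitian) (r : ℝ[X]) :
    (aeval A r).trace = ∑ i, r.eval (hA.eigenvalues i) := by
  rw [hA.aeval_eq_conj_diagonal, Unitary.conjStarAlgAut_apply, trace_mul_comm, ← mul_assoc]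
  simp

lemma aeval_eq_zero_iff (hA : A.IsHermitian) (r : ℝ[X]) :
    aeval A r = 0 ↔ ∀ μ ∈ spectrum ℝ A, r.eval μ = 0 := by
  rw [hA.aeval_eq_conj_diagonal, map_eq_zero_iff _ (EquivLike.injective _),
    diagonal_eq_zero, hA.spectrum_real_eq_range_eigenvalues]
  simp [funext_iff]

/-- Symmetric matrices all of whose polynomials have equal traces have the same eigenvalues, with
multiplicity. -/
theorem roots_charpoly_eq_of_trace_aeval_eq (hA : A.IsHermitian) (hB : B.IsHermitian)
    (h : ∀ r : ℝ[X], (aeval A r).trace = (aeval B r).trace) :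
    A.charpoly.roots = B.charpoly.roots := by
  rw [hA.roots_charpoly_eq_eigenvalues, hB.roots_charpoly_eq_eigenvalues]
  ext μ
  let S : Finset ℝ := (Finset.univ.image hA.eigenvalues ∪ Finset.univ.image hB.eigenvalues).erase μ
  have hμ := eval_prod_X_sub_C_erase_ne_zero
    (Finset.univ.image hA.eigenvalues ∪ Finset.univ.image hB.eigenvalues) μ
  have h1 := h (∏ x ∈ S, (X - C x))
  rw [hA.trace_aeval_eq_sum, hB.trace_aeval_eq_sum, sum_eval_prod_X_sub_C_erase _ _ _ fun i => ?_,
    sum_eval_prod_X_sub_C_erase _ _ _ fun i => ?_] at h1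
  · exact_mod_cast mul_right_cancel₀ hμ h1
  · simp
  · simp

end Matrix.IsHermitian

namespace Matrix
open Polynomial

lemma aeval_mulVec_of_mulVec_eq_smul {ι : Type*} [Fintype ι] [DecidableEq ι] {A : Matrix ι ι ℝ}
    {v : ι → ℝ} {c : ℝ} (h : A *ᵥ v = c • v) (r : ℝ[X]) : aeval A r *ᵥ v = r.eval c • v := by
  induction r using Polynomial.induction_on' with
  | add p q hp hq => rw [map_add, add_mulVec, hp, hq, eval_add, add_smul]
  | monomial m a =>
    have : A ^ m *ᵥ v = c ^ m • v := by
      induction m with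
      | zero => simp
      | succ m ih => rw [pow_succ, ← mulVec_mulVec, h, mulVec_smul, ih, smul_smul, pow_succ']
    rw [aeval_monomial, eval_monomial, Algebra.algebraMap_eq_smul_one, smul_mul_assoc, one_mul,
      smul_mulVec, this, smul_smul]

end Matrix

/-! ### Ball, Hoffman and annihilating polynomials. -/

namespace PointLineGeometry

open Polynomial

section CommRing

variable {R : Type*} [CommRing R] (s t : R)

lemma distPoly_monic_degree [Nontrivial R] (i : ℕ) :
    (distPoly s t i).Monic ∧ (distPoly s t i).degree = i := by
  have hlin : (X + C (1 - s) : R[X]).Monic ∧ (X + C (1 - s) : R[X]).degree = 1 :=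
    ⟨monic_X_add_C _, degree_X_add_C _⟩
  have step : ∀ p q : R[X], ∀ i : ℕ, p.Monic → p.degree = (i : ℕ) →
      q.degree < ((i + 1 : ℕ) : WithBot ℕ) →
      (p * (X + C (1 - s)) - q).Monic ∧
        (p * (X + C (1 - s)) - q).degree = ((i + 1 : ℕ) : WithBot ℕ) := by
    intro p q i hp hd hq
    have h1 : (p * (X + C (1 - s))).degree = ((i + 1 : ℕ) : WithBot ℕ) := by
      rw [hlin.1.degree_mul, hd, hlin.2]
      rfl
    rw [← h1] at hq ⊢
    exact ⟨(hp.mul hlin.1).sub_of_left hq, degree_sub_eq_left_of_degree_lt hq⟩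
  induction i using Nat.strong_induction_on with
  | _ i ih =>
    match i with
    | 0 => exact ⟨monic_one, degree_one⟩
    | 1 => exact ⟨monic_X, degree_X⟩
    | 2 =>
      refine step X _ 1 monic_X degree_X (degree_C_le.trans_lt ?_)
      exact_mod_cast Nat.zero_lt_succ 1
    | i + 3 =>
      obtain ⟨h1, h2⟩ := ih (i + 2) (by omega)
      refine step _ _ _ h1 h2 ?_
      rw [← smul_eq_C_mul]
      refine (degree_smul_le _ _).trans_lt ?_
      rw [(ih (i + 1) (by omega)).2]
      exact_mod_cast (show i + 1 < i + 2 + 1 by omega)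

lemma distPoly_monic [Nontrivial R] (i : ℕ) : (distPoly s t i).Monic :=
  (distPoly_monic_degree s t i).1

lemma degree_distPoly [Nontrivial R] (i : ℕ) : (distPoly s t i).degree = i :=
  (distPoly_monic_degree s t i).2

/-- The sum of the first `m + 1` distance polynomials. -/
noncomputable def ballPoly (m : ℕ) : R[X] := ∑ i ∈ Finset.range (m + 1), distPoly s t i

lemma ballPoly_zero : ballPoly s t 0 = 1 := by simp [ballPoly, distPoly]

lemma ballPoly_succ (m : ℕ) : ballPoly s t (m + 1) = ballPoly s t m + distPoly s t (m + 1) :=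
  Finset.sum_range_succ _ _

lemma ballPoly_one : ballPoly s t 1 = X + 1 := by
  rw [ballPoly_succ, ballPoly_zero, distPoly, add_comm]

/-- Summation absorbs the exceptional constant of `distPoly`, leaving a uniform recurrence from `1`
and `X + 1`. -/
lemma ballPoly_add_two (m : ℕ) :
    ballPoly s t (m + 2) =
      (X + C (1 - s)) * ballPoly s t (m + 1) - C (s * t) * ballPoly s t m := by
  induction m with
  | zero =>
    rw [ballPoly_succ, ballPoly_one, ballPoly_zero, distPoly]
    simp only [map_sub, map_mul, map_add, map_one]
    ring
  | succ m ih =>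
    have h : distPoly s t (m + 3) =
      distPoly s t (m + 2) * (X + C (1 - s)) - C (s * t) * distPoly s t (m + 1) := rfl
    linear_combination ballPoly_succ s t (m + 2) + h + ih -
      (X + C (1 - s)) * ballPoly_succ s t (m + 1) + C (s * t) * ballPoly_succ s t m

lemma degree_ballPoly_sub_lt [Nontrivial R] (m : ℕ) :
    (ballPoly s t m - distPoly s t m).degree < (m : WithBot ℕ) := by
  rw [ballPoly, Finset.sum_range_succ, add_sub_cancel_right]
  rw [← mem_degreeLT]
  refine sum_mem fun i hi => mem_degreeLT.2 ?_
  rw [degree_distPoly]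
  exact_mod_cast Finset.mem_range.1 hi

lemma degree_ballPoly [Nontrivial R] (m : ℕ) : (ballPoly s t m).degree = m := by
  have := degree_ballPoly_sub_lt s t m
  rw [← degree_distPoly s t m] at this
  rw [← sub_add_cancel (ballPoly s t m) (distPoly s t m),
    degree_add_eq_right_of_degree_lt this, degree_distPoly]

lemma ballPoly_monic [Nontrivial R] (m : ℕ) : (ballPoly s t m).Monic := by
  have := degree_ballPoly_sub_lt s t m
  rw [← degree_distPoly s t m] at this
  rw [← sub_add_cancel (ballPoly s t m) (distPoly s t m)]
  exact (distPoly_monic s t m).add_of_right this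

/-- At this point the recurrence has characteristic roots `-s` and `-t`, and the initial values `1`,
`-t` select the second. -/
lemma eval_ballPoly_neg (m : ℕ) : (ballPoly s t m).eval (-(t + 1)) = (-t) ^ m := by
  induction m using Nat.strong_induction_on with
  | _ m ih =>
    match m with
    | 0 => simp [ballPoly_zero]
    | 1 => simp [ballPoly_one]
    | m + 2 =>
      rw [ballPoly_add_two, eval_sub, eval_mul, eval_mul, ih m (by omega), ih (m + 1) (by omega)]
      simp only [eval_add, eval_X, eval_C]
      ring

end CommRing

/-- For `s = t` the substitution turns `X + 1 - s` into `y * s`, so powers of `s` factor out. What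
remains is a monic integer polynomial, open to the rational root theorem. -/
lemma eval_ballPoly_eq_pow_mul (s : ℕ) (y : ℝ) (m : ℕ) :
    (ballPoly (s : ℝ) s m).eval (y * s + s - 1) = s ^ m * aeval y (ballPoly (1 : ℤ) 1 m) := by
  induction m using Nat.strong_induction_on with
  | _ m ih =>
    match m with
    | 0 => simp [ballPoly_zero]
    | 1 =>
      simp only [ballPoly_one, eval_add, eval_X, eval_one, map_add, aeval_X, map_one]
      ring
    | m + 2 =>
      rw [ballPoly_add_two, ballPoly_add_two, eval_sub, eval_mul, eval_mul, ih m (by omega),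
        ih (m + 1) (by omega)]
      simp only [eval_add, eval_X, map_sub, map_mul, aeval_X, sub_self,
        map_zero, add_zero, mul_one, one_mul, map_one]
      simp only [eval_sub, eval_one, eval_mul, eval_C]
      ring

lemma eval_ballPoly_one_one_ne_zero {y : ℤ} (hy : y ≤ -2) (m : ℕ) :
    (ballPoly (1 : ℤ) 1 m).eval y ≠ 0 := by
  -- With the signs removed, the values satisfy `c (m + 2) = -y * c (m + 1) - c m` with `-y ≥ 2`, so
  -- they stay positive and nondecreasing.
  have key : ∀ m, 0 < (-1) ^ m * (ballPoly (1 : ℤ) 1 m).eval y ∧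
      (-1) ^ m * (ballPoly (1 : ℤ) 1 m).eval y ≤
        (-1) ^ (m + 1) * (ballPoly (1 : ℤ) 1 (m + 1)).eval y := by
    intro m
    induction m with
    | zero =>
      rw [zero_add, ballPoly_zero, ballPoly_one]
      simp only [eval_add, eval_X, eval_one]
      constructor <;> linarith
    | succ m ih =>
      obtain ⟨h1, h2⟩ := ih
      refine ⟨h1.trans_le h2, ?_⟩
      have h3 : (-1) ^ (m + 1 + 1) * (ballPoly (1 : ℤ) 1 (m + 1 + 1)).eval y =
          -y * ((-1) ^ (m + 1) * (ballPoly (1 : ℤ) 1 (m + 1)).eval y) -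
            (-1) ^ m * (ballPoly (1 : ℤ) 1 m).eval y := by
        rw [ballPoly_add_two]
        simp only [eval_sub, eval_mul, eval_add, eval_X, eval_C]
        ring
      rw [h3]
      nlinarith
  intro h0
  have := (key m).1
  rw [h0] at this
  simp at this

/-- No number `-(t + 1)` with `t > 0` is a root of a ball polynomial with equal parameters. -/
lemma eval_ballPoly_neg_ne_zero {s t : ℕ} (hs : 0 < s) (ht : 0 < t) (m : ℕ) :
    (ballPoly (s : ℝ) s m).eval (-(t + 1 : ℝ)) ≠ 0 := by
  intro h0
  have hs' : (s : ℝ) ≠ 0 := by positivity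
  have hsq : (s : ℚ) ≠ 0 := by positivity
  -- Chosen so that `y * s + s - 1 = -(t + 1)`. A rational root is an integer, and `y < -1` then
  -- forces `y ≤ -2`.
  set y : ℚ := -(t + s) / s with hy
  have hy' : (y : ℝ) * s = -(t + s) := by
    rw [hy]
    push_cast
    field_simp
  have h1 := eval_ballPoly_eq_pow_mul s (y : ℝ) m
  rw [hy', show (-(t + s) + s - 1 : ℝ) = -(t + 1) by ring, h0, eq_comm] at h1
  have h2 := (mul_eq_zero.1 h1).resolve_left (pow_ne_zero _ hs')
  have h3 : aeval y (ballPoly (1 : ℤ) 1 m) = 0 :=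
    (aeval_algebraMap_eq_zero_iff ℝ y (ballPoly (1 : ℤ) 1 m)).1 h2
  obtain ⟨a, ha⟩ := isInteger_of_is_root_of_monic (ballPoly_monic (1 : ℤ) 1 m) h3
  rw [← ha, aeval_algebraMap_eq_zero_iff, coe_aeval_eq_eval] at h3
  refine eval_ballPoly_one_one_ne_zero (y := a) ?_ m h3
  have hlt : (a : ℚ) < -1 := by
    change (algebraMap ℤ ℚ a) < -1
    rw [ha, hy, div_lt_iff₀ (by positivity)]
    have : (0 : ℚ) < t := by exact_mod_cast ht
    linarith
  have : a < -1 := by exact_mod_cast hlt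
  omega

/-- The polynomial sending the collinearity matrix of a generalized `n`-gon of order `(s, t)` to
the all-ones matrix. -/
noncomputable def hoffmanPoly (n s t : ℕ) : ℝ[X] :=
  if Even n then ballPoly (s : ℝ) t (n / 2 - 1) + C (t + 1 : ℝ)⁻¹ * distPoly (s : ℝ) t (n / 2)
  else ballPoly (s : ℝ) t (n / 2)

lemma degree_hoffmanPoly {n : ℕ} (hn : 2 ≤ n) (s t : ℕ) :
    (hoffmanPoly n s t).degree = (n / 2 : ℕ) := by
  have ht : ((t : ℝ) + 1)⁻¹ ≠ 0 := by positivity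
  rw [hoffmanPoly]
  split_ifs
  · rw [degree_add_eq_right_of_degree_lt] <;> rw [degree_C_mul ht, degree_distPoly]
    rw [degree_ballPoly]
    exact_mod_cast (show n / 2 - 1 < n / 2 by omega)
  · exact degree_ballPoly _ _ _

/-- With `n = 2 * (m + 1)`, the last distance polynomial has value `(-t) ^ (m + 1) - (-t) ^ m = -(t
+ 1) * (-t) ^ m`, which after division by `t + 1` cancels the ball polynomial. -/
lemma eval_hoffmanPoly_of_even {n : ℕ} (hn : 3 ≤ n) (hn' : Even n) (s t : ℕ) :
    (hoffmanPoly n s t).eval (-(t + 1 : ℝ)) = 0 := by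
  obtain ⟨m, rfl⟩ : ∃ m, n = 2 * (m + 1) := by
    obtain ⟨k, rfl⟩ := hn'.two_dvd
    exact ⟨k - 1, by omega⟩
  have h1 := eval_ballPoly_neg (s : ℝ) (t : ℝ) (m + 1)
  have h2 := eval_ballPoly_neg (s : ℝ) (t : ℝ) m
  rw [ballPoly_succ, eval_add, h2] at h1
  have ht : ((t : ℝ) + 1) ≠ 0 := by positivity
  rw [hoffmanPoly, if_pos hn', Nat.mul_div_cancel_left _ two_pos, Nat.add_sub_cancel, eval_add, h2,
    eval_mul, eval_C, eq_sub_of_add_eq' h1]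
  field_simp
  ring

/-- The minimal polynomial of the collinearity matrix, up to a scalar. -/
noncomputable def annihilatingPoly (n s t : ℕ) : ℝ[X] :=
  (X - C (s * (t + 1) : ℝ)) * hoffmanPoly n s t

lemma degree_annihilatingPoly {n : ℕ} (hn : 2 ≤ n) (s t : ℕ) :
    (annihilatingPoly n s t).degree = (n / 2 + 1 : ℕ) := by
  rw [annihilatingPoly, degree_mul, degree_X_sub_C, degree_hoffmanPoly hn, add_comm]
  rfl

end PointLineGeometry

/-! ### The spectrum of the collinearity matrix. -/

namespace PointLineGeometry

open Polynomial

variable {P L : Type*} {Γ : PointLineGeometry P L} {n s t : ℕ}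

lemma isHermitian_collinearityMatrix : Γ.collinearityMatrix.IsHermitian := by
  classical
  exact Matrix.isHermitian_iff_isSymm.2 (SimpleGraph.isSymm_adjMatrix _)

namespace IsGeneralizedPolygon

open Matrix

lemma collinearityMatrix_mulVec_one [Fintype P] [Finite L] (h : Γ.IsGeneralizedPolygon n)
    (ho : Γ.HasOrder s t) :
    Γ.collinearityMatrix *ᵥ (fun _ => 1) = (s * (t + 1) : ℝ) • (fun _ => (1 : ℝ)) := by
  classical
  cases nonempty_fintype L
  have hM := h.incMatrix_mul_transpose ho
  have h1 : Γ.incMatrix *ᵥ (fun _ => 1) = (t + 1 : ℝ) • (fun _ => (1 : ℝ)) := by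
    ext x
    have := ho.lines_through x
    rw [Set.ncard_eq_toFinset_card', Set.toFinset_ofPred] at this
    simp [Matrix.mulVec, dotProduct, incMatrix, this]
  have h2 : Γ.incMatrix.transpose *ᵥ (fun _ => 1) = (s + 1 : ℝ) • (fun _ => (1 : ℝ)) := by
    ext l
    have := ho.points_on l
    rw [Set.ncard_eq_toFinset_card', Set.toFinset_ofPred] at this
    simp [Matrix.mulVec, dotProduct, incMatrix, this]
  have h3 := congrArg (· *ᵥ (fun _ => (1 : ℝ))) hM
  simp only [← mulVec_mulVec, h2, mulVec_smul, h1, add_mulVec, smul_mulVec, one_mulVec] at h3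
  rw [eq_sub_of_add_eq h3.symm]
  module

/-- Distances between points are even and at most `n`, so the distance matrices sum to the all-ones
matrix. -/
theorem aeval_hoffmanPoly [Fintype P] [DecidableEq P] [Finite L] (h : Γ.IsGeneralizedPolygon n)
    (ho : Γ.HasOrder s t) :
    aeval Γ.collinearityMatrix (hoffmanPoly n s t) = Matrix.of fun _ _ => 1 := by
  classical
  have h3 := h.three_le
  have ht : ((t : ℝ) + 1) ≠ 0 := by positivity
  have hball : ∀ m, 2 * m < n → ∀ x y, aeval Γ.collinearityMatrix (ballPoly (s : ℝ) t m) x y =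
      if Γ.incidenceGraph.dist (.inl x) (.inl y) ≤ 2 * m then 1 else 0 := by
    intro m hm x y
    obtain ⟨j, hj⟩ := ((even_dist_iff h.hasProjections.connected (.inl x) (.inl y)).2
      (by simp)).two_dvd
    have : ∀ i ∈ Finset.range (m + 1), aeval Γ.collinearityMatrix (distPoly (s : ℝ) t i) x y =
        if i = j then 1 else 0 := by
      intro i hi
      have := Finset.mem_range.1 hi
      rw [h.aeval_distPoly ho (by omega), if_neg (by omega), one_smul, pointDistMatrix,
        Matrix.of_apply, hj]
      exact if_congr (by omega) rfl rfl
    rw [ballPoly, map_sum, Matrix.sum_apply, Finset.sum_congr rfl this, hj]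
    simp only [Finset.sum_ite_eq', Finset.mem_range]
    exact if_congr (by omega) rfl rfl
  ext x y
  have hle := h.hasProjections.dist_le (.inl x) (.inl y)
  have hev := (even_dist_iff h.hasProjections.connected (.inl x) (.inl y)).2 (by simp)
  rw [hoffmanPoly]
  split_ifs with hn
  · have hd := h.aeval_distPoly ho (i := n / 2) (by omega)
    obtain ⟨k, rfl⟩ := hn.two_dvd
    obtain ⟨j, hj⟩ := hev.two_dvd
    rw [Nat.mul_div_cancel_left _ two_pos] at hd ⊢
    rw [if_pos rfl] at hd
    rw [map_add, map_mul, hd, aeval_C, Algebra.algebraMap_eq_smul_one, smul_mul_assoc, one_mul,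
      smul_smul, inv_mul_cancel₀ ht, one_smul, Matrix.add_apply, hball _ (by omega),
      pointDistMatrix, Matrix.of_apply, Matrix.of_apply, hj]
    by_cases hjk : j = k
    · rw [if_neg (by omega), if_pos (by omega), zero_add]
    · rw [if_pos (by omega), if_neg (by omega), add_zero]
  · obtain ⟨j, hj⟩ := hev.two_dvd
    rw [Nat.even_iff] at hn
    rw [hball (n / 2) (by omega), if_pos (by omega), Matrix.of_apply]

lemma aeval_annihilatingPoly [Fintype P] [DecidableEq P] [Finite L]
    (h : Γ.IsGeneralizedPolygon n) (ho : Γ.HasOrder s t) :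
    aeval Γ.collinearityMatrix (annihilatingPoly n s t) = 0 := by
  have h1 := h.collinearityMatrix_mulVec_one ho
  rw [annihilatingPoly, map_mul, h.aeval_hoffmanPoly ho, map_sub, aeval_X, aeval_C,
    Algebra.algebraMap_eq_smul_one, Matrix.sub_mul, Matrix.smul_mul, Matrix.one_mul]
  ext x y
  have := congrFun h1 x
  simp only [mulVec, dotProduct, mul_one, Pi.smul_apply, smul_eq_mul] at this
  simp [Matrix.mul_apply, this]

/-- Both sides are the eigenvalue of the all-ones matrix on the all-ones vector. -/
lemma card_points [Fintype P] [Finite L] (h : Γ.IsGeneralizedPolygon n) (ho : Γ.HasOrder s t) :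
    (Fintype.card P : ℝ) = (hoffmanPoly n s t).eval (s * (t + 1) : ℝ) := by
  classical
  obtain ⟨c⟩ := h.thick
  have h1 := aeval_mulVec_of_mulVec_eq_smul (h.collinearityMatrix_mulVec_one ho)
    (hoffmanPoly n s t)
  rw [h.aeval_hoffmanPoly ho] at h1
  simpa [mulVec, dotProduct] using congrFun h1 (c.point 0)

lemma trace_aeval_distPoly_succ [Fintype P] [DecidableEq P] [Finite L]
    (h : Γ.IsGeneralizedPolygon n) (ho : Γ.HasOrder s t) {i : ℕ} (hi : 2 * (i + 1) ≤ n) :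
    (aeval Γ.collinearityMatrix (distPoly (s : ℝ) t (i + 1))).trace = 0 := by
  rw [h.aeval_distPoly ho hi, trace_smul]
  simp [Matrix.trace, pointDistMatrix]

lemma pow_collinearityMatrix_apply_eq_zero [Fintype P] [DecidableEq P]
    (h : Γ.IsGeneralizedPolygon n) {j : ℕ} {x y : P}
    (hd : 2 * j < Γ.incidenceGraph.dist (.inl x) (.inl y)) :
    (Γ.collinearityMatrix ^ j) x y = 0 := by
  classical
  induction j generalizing y with
  | zero =>
    rw [pow_zero, Matrix.one_apply_ne]
    rintro rfl
    simp at hd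
  | succ j ih =>
    rw [pow_succ, Matrix.mul_apply]
    refine Finset.sum_eq_zero fun z _ => ?_
    rw [← h.pointDistMatrix_one]
    by_cases hz : Γ.incidenceGraph.dist (.inl z) (.inl y) = 2 * 1
    · have := h.hasProjections.connected.dist_triangle (u := .inl x) (v := .inl z) (w := .inl y)
      rw [h.pointDistMatrix_one, ih (by omega), zero_mul]
    · rw [pointDistMatrix, Matrix.of_apply, if_neg hz, mul_zero]

lemma aeval_apply_eq_zero [Fintype P] [DecidableEq P] (h : Γ.IsGeneralizedPolygon n) {x y : P}
    {r : ℝ[X]} {m : ℕ} (hr : r.degree < m)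
    (hd : 2 * m ≤ Γ.incidenceGraph.dist (.inl x) (.inl y)) :
    aeval Γ.collinearityMatrix r x y = 0 := by
  rw [aeval_eq_sum_range, Matrix.sum_apply]
  refine Finset.sum_eq_zero fun j _ => ?_
  by_cases hj : r.coeff j = 0
  · rw [hj, zero_smul, Matrix.zero_apply]
  · have hjm : j < m := by exact_mod_cast (le_degree_of_ne_zero hj).trans_lt hr
    rw [Matrix.smul_apply, h.pow_collinearityMatrix_apply_eq_zero (by omega), smul_zero]

/-- Polynomials of degree at most `n / 2` do not annihilate the collinearity matrix. -/
lemma aeval_ne_zero [Fintype P] [DecidableEq P] [Finite L] (h : Γ.IsGeneralizedPolygon n)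
    (ho : Γ.HasOrder s t) {r : ℝ[X]} (hr : r ≠ 0) (hdeg : r.natDegree ≤ n / 2) :
    aeval Γ.collinearityMatrix r ≠ 0 := by
  classical
  intro h0
  obtain ⟨c⟩ := h.thick
  have hm : 2 * r.natDegree ≤ n := by omega
  obtain ⟨y, hy⟩ := h.exists_dist_eq (.inl (c.point 0)) hm
  have hev := (even_dist_iff h.hasProjections.connected (.inl (c.point 0)) y).1
    (hy ▸ even_two_mul _)
  rcases y with y | l
  swap
  · simp at hev
  have hlc : r.leadingCoeff ≠ 0 := leadingCoeff_ne_zero.2 hr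
  have hmon := distPoly_monic (s : ℝ) (t : ℝ) r.natDegree
  have hdegp := degree_distPoly (s : ℝ) (t : ℝ) r.natDegree
  -- At a pair of points at distance `2 * r.natDegree` the lower-degree remainder contributes
  -- nothing, so the entry of `r(A)` is a nonzero multiple of the leading coefficient.
  have hlt : (r - C r.leadingCoeff * distPoly (s : ℝ) t r.natDegree).degree < r.natDegree := by
    rw [← degree_eq_natDegree hr]
    refine degree_sub_lt_left ?_ hr ?_
    · rw [degree_C_mul hlc, hdegp, degree_eq_natDegree hr]
    · rw [leadingCoeff_mul, leadingCoeff_C, hmon.leadingCoeff, mul_one]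
  have h1 := h.aeval_apply_eq_zero hlt hy.ge
  rw [map_sub, h0, map_mul, h.aeval_distPoly ho hm, aeval_C, Algebra.algebraMap_eq_smul_one,
    smul_mul_assoc, one_mul, zero_sub, Matrix.neg_apply, Matrix.smul_apply, Matrix.smul_apply,
    pointDistMatrix, Matrix.of_apply, if_pos hy, neg_eq_zero, smul_eq_mul, smul_eq_mul,
    mul_one] at h1
  rcases mul_eq_zero.1 h1 with h2 | h2
  · exact hlc h2
  · split_ifs at h2
    · have : (t : ℝ) + 1 ≠ 0 := by positivity
      exact this h2
    · exact one_ne_zero h2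

theorem spectrum_collinearityMatrix [Fintype P] [DecidableEq P] [Finite L]
    (h : Γ.IsGeneralizedPolygon n) (ho : Γ.HasOrder s t) :
    spectrum ℝ Γ.collinearityMatrix = {μ | (annihilatingPoly n s t).eval μ = 0} ∧
      (spectrum ℝ Γ.collinearityMatrix).ncard = n / 2 + 1 := by
  have hA := isHermitian_collinearityMatrix (Γ := Γ)
  have h3 := h.three_le
  set q := annihilatingPoly n s t with hq
  have hqd : q.degree = (n / 2 + 1 : ℕ) := degree_annihilatingPoly (by omega) s t
  have hq0 : q ≠ 0 := by
    intro h0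
    rw [h0, degree_zero] at hqd
    exact absurd hqd.symm (WithBot.coe_ne_bot)
  have hroots : {μ | q.eval μ = 0} = (q.roots.toFinset : Set ℝ) := by
    ext μ
    simp [hq0]
  have hfin : (spectrum ℝ Γ.collinearityMatrix).Finite := Matrix.finite_real_spectrum
  have hsub : hfin.toFinset ⊆ q.roots.toFinset := by
    intro μ hμ
    have := (hA.aeval_eq_zero_iff q).1 (h.aeval_annihilatingPoly ho) μ (by simpa using hμ)
    simpa [hq0] using this
  have hcard : q.roots.toFinset.card ≤ n / 2 + 1 :=
    (Multiset.toFinset_card_le _).trans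
      ((card_roots' q).trans (natDegree_eq_of_degree_eq_some hqd).le)
  -- A symmetric matrix is annihilated by the product of `X - μ` over its distinct eigenvalues.
  have hcard' : n / 2 + 1 ≤ hfin.toFinset.card := by
    by_contra hlt
    have hmon : (∏ μ ∈ hfin.toFinset, (X - C μ)).Monic := monic_prod_of_monic _ _ fun μ _ =>
      monic_X_sub_C μ
    refine h.aeval_ne_zero ho hmon.ne_zero ?_ ((hA.aeval_eq_zero_iff _).2 fun μ hμ => ?_)
    · rw [natDegree_finsetProd_X_sub_C_eq_card]
      omega
    · rw [eval_prod]
      exact Finset.prod_eq_zero (hfin.mem_toFinset.2 hμ) (by simp)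
  have heq := Finset.eq_of_subset_of_card_le hsub (hcard.trans hcard')
  have hcoe : spectrum ℝ Γ.collinearityMatrix = (hfin.toFinset : Set ℝ) := by simp
  constructor
  · rw [hroots, ← heq, ← hcoe]
  · rw [Set.ncard_eq_toFinset_card _ hfin]
    exact le_antisymm (heq ▸ hcard) hcard'

lemma mem_spectrum_iff [Fintype P] [DecidableEq P] [Finite L] (h : Γ.IsGeneralizedPolygon n)
    (ho : Γ.HasOrder s t) {μ : ℝ} : μ ∈ spectrum ℝ Γ.collinearityMatrix ↔
      μ = s * (t + 1) ∨ (hoffmanPoly n s t).eval μ = 0 := by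
  rw [(h.spectrum_collinearityMatrix ho).1, Set.mem_ofPred_eq, annihilatingPoly, eval_mul,
    mul_eq_zero, eval_sub, eval_X, eval_C, sub_eq_zero]

/-- Gershgorin's theorem: the diagonal is zero and the entries are nonnegative with row sum `s * (t
+ 1)`. -/
lemma le_of_mem_spectrum [Fintype P] [DecidableEq P] [Finite L] (h : Γ.IsGeneralizedPolygon n)
    (ho : Γ.HasOrder s t) {μ : ℝ} (hμ : μ ∈ spectrum ℝ Γ.collinearityMatrix) :
    μ ≤ s * (t + 1) := by
  classical
  rw [← Matrix.spectrum_toLin', ← Module.End.hasEigenvalue_iff_mem_spectrum] at hμ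
  obtain ⟨x, hx⟩ := eigenvalue_mem_ball hμ
  have hxx : Γ.collinearityMatrix x x = 0 := by simp [collinearityMatrix]
  have hnn : ∀ y, ‖Γ.collinearityMatrix x y‖ = Γ.collinearityMatrix x y := fun y => by
    refine Real.norm_of_nonneg ?_
    rw [collinearityMatrix, SimpleGraph.adjMatrix_apply]
    split_ifs <;> norm_num
  have hsum := congrFun (h.collinearityMatrix_mulVec_one ho) x
  simp only [mulVec, dotProduct, mul_one, Pi.smul_apply, smul_eq_mul] at hsum
  rw [hxx, mem_closedBall_zero_iff, Finset.sum_congr rfl fun y _ => hnn y,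
    Finset.sum_erase _ hxx, hsum] at hx
  exact (le_abs_self μ).trans hx

/-- With `N` the incidence matrix, `A + (t + 1) I = N Nᵀ` is positive semidefinite. -/
lemma neg_le_of_mem_spectrum [Fintype P] [DecidableEq P] [Finite L]
    (h : Γ.IsGeneralizedPolygon n) (ho : Γ.HasOrder s t) {μ : ℝ}
    (hμ : μ ∈ spectrum ℝ Γ.collinearityMatrix) : -(t + 1 : ℝ) ≤ μ := by
  cases nonempty_fintype L
  have hM := h.incMatrix_mul_transpose ho
  have hpsd : (Γ.incMatrix * Γ.incMatrix.transpose).PosSemidef := by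
    simpa using Matrix.posSemidef_self_mul_conjTranspose Γ.incMatrix
  rw [hM] at hpsd
  have hmem : μ + (t + 1 : ℝ) ∈ spectrum ℝ (Γ.collinearityMatrix + (t + 1 : ℝ) • 1) := by
    rw [add_comm Γ.collinearityMatrix, ← Algebra.algebraMap_eq_smul_one]
    exact spectrum.add_mem_add_iff.2 hμ
  rw [hpsd.isHermitian.spectrum_real_eq_range_eigenvalues] at hmem
  obtain ⟨i, hi⟩ := hmem
  have := hpsd.eigenvalues_nonneg i
  linarith

lemma neg_mem_spectrum_of_even [Fintype P] [DecidableEq P] [Finite L]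
    (h : Γ.IsGeneralizedPolygon n) (ho : Γ.HasOrder s t) (hn : Even n) :
    -(t + 1 : ℝ) ∈ spectrum ℝ Γ.collinearityMatrix :=
  (h.mem_spectrum_iff ho).2 (.inr (eval_hoffmanPoly_of_even h.three_le hn s t))

/-- Here `t'` is arbitrary because it will come from the other polygon, whose order is not yet known
to agree. -/
lemma neg_notMem_spectrum_of_odd [Fintype P] [DecidableEq P] [Finite L]
    (h : Γ.IsGeneralizedPolygon n) (ho : Γ.HasOrder s t) (hn : Odd n) {t' : ℕ} (ht' : 0 < t') :
    -(t' + 1 : ℝ) ∉ spectrum ℝ Γ.collinearityMatrix := by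
  obtain rfl := h.order_eq_of_odd hn ho
  rw [h.mem_spectrum_iff ho, hoffmanPoly, if_neg (Nat.not_even_iff_odd.2 hn), not_or]
  constructor
  · have : (0 : ℝ) ≤ s * (s + 1) := by positivity
    intro h'
    have : (0 : ℝ) < t' := by exact_mod_cast ht'
    linarith
  · exact eval_ballPoly_neg_ne_zero (by have := ho.one_lt_left; omega) ht' _

end IsGeneralizedPolygon

lemma spectrum_eq_of_pointSpectrum_eq {P' L' : Type*} [Fintype P] [DecidableEq P] [Fintype P']
    [DecidableEq P'] {Γ' : PointLineGeometry P' L'} (h : Γ.pointSpectrum = Γ'.pointSpectrum) :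
    spectrum ℝ Γ.collinearityMatrix = spectrum ℝ Γ'.collinearityMatrix := by
  ext μ
  rw [Matrix.mem_spectrum_iff_isRoot_charpoly, Matrix.mem_spectrum_iff_isRoot_charpoly,
    ← mem_roots (Matrix.charpoly_monic _).ne_zero, ← mem_roots (Matrix.charpoly_monic _).ne_zero]
  exact iff_of_eq (congrArg (μ ∈ ·) h)

/-! ### Comparison of two generalized polygons. -/

section Comparison

variable {P' L' : Type*} [Fintype P] [DecidableEq P] [Finite L] [Fintype P'] [DecidableEq P']
  [Finite L'] {Γ' : PointLineGeometry P' L'} {n' s' t' : ℕ}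

/-- The distance polynomials up to index `n / 2`, followed by multiples of the annihilating
polynomial. -/
noncomputable def traceSequence (n s t : ℕ) (hn : 2 ≤ n) : Polynomial.Sequence ℝ where
  elems' i := if i ≤ n / 2 then distPoly (s : ℝ) t i
    else annihilatingPoly n s t * X ^ (i - (n / 2 + 1))
  degree_eq' i := by
    split_ifs with hi
    · exact degree_distPoly _ _ _
    · rw [degree_mul, degree_annihilatingPoly hn, degree_X_pow]
      exact_mod_cast (show n / 2 + 1 + (i - (n / 2 + 1)) = i by omega)

theorem IsGeneralizedPolygon.trace_aeval_eq (h : Γ.IsGeneralizedPolygon n)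
    (h' : Γ'.IsGeneralizedPolygon n) (ho : Γ.HasOrder s t) (ho' : Γ'.HasOrder s t) (r : ℝ[X]) :
    (aeval Γ.collinearityMatrix r).trace = (aeval Γ'.collinearityMatrix r).trace := by
  have h3 := h.three_le
  -- One polynomial in each degree gives a basis of `ℝ[X]`. On it the trace is the number of points
  -- for `1` and zero otherwise.
  let S := traceSequence n s t (by omega)
  have hspan := S.span fun i => (leadingCoeff_ne_zero.2 (S.ne_zero i)).isUnit
  have hr : r ∈ Submodule.span ℝ (Set.range S) := hspan ▸ Submodule.mem_top
  induction hr using Submodule.span_induction with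
  | mem x hx =>
    obtain ⟨i, rfl⟩ := hx
    change (aeval Γ.collinearityMatrix (ite _ _ _)).trace =
      (aeval Γ'.collinearityMatrix (ite _ _ _)).trace
    split_ifs with hi
    · cases i with
      | zero =>
        rw [distPoly, map_one, map_one, Matrix.trace_one, Matrix.trace_one, h.card_points ho,
          h'.card_points ho']
      | succ i =>
        rw [h.trace_aeval_distPoly_succ ho (by omega), h'.trace_aeval_distPoly_succ ho' (by omega)]
    · rw [map_mul, map_mul, h.aeval_annihilatingPoly ho, h'.aeval_annihilatingPoly ho', zero_mul,
        zero_mul, Matrix.trace_zero, Matrix.trace_zero]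
  | zero => simp
  | add x y _ _ hx hy => rw [map_add, map_add, Matrix.trace_add, Matrix.trace_add, hx, hy]
  | smul a x _ hx => rw [map_smul, map_smul, Matrix.trace_smul, Matrix.trace_smul, hx]

theorem IsGeneralizedPolygon.pointSpectrum_eq (h : Γ.IsGeneralizedPolygon n)
    (h' : Γ'.IsGeneralizedPolygon n) (ho : Γ.HasOrder s t) (ho' : Γ'.HasOrder s t) :
    Γ.pointSpectrum = Γ'.pointSpectrum :=
  isHermitian_collinearityMatrix.roots_charpoly_eq_of_trace_aeval_eq isHermitian_collinearityMatrix
    (h.trace_aeval_eq h' ho ho')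

lemma even_of_spectrum_eq (h : Γ.IsGeneralizedPolygon n) (h' : Γ'.IsGeneralizedPolygon n')
    (ho : Γ.HasOrder s t) (ho' : Γ'.HasOrder s' t')
    (heq : spectrum ℝ Γ.collinearityMatrix = spectrum ℝ Γ'.collinearityMatrix) (hn : Even n) :
    Even n' := by
  by_contra hn'
  have := ho.one_lt_right
  refine h'.neg_notMem_spectrum_of_odd ho' (Nat.not_even_iff_odd.1 hn') (t' := t) (by omega) ?_
  rw [← heq]
  exact h.neg_mem_spectrum_of_even ho hn

theorem eq_of_spectrum_eq (h : Γ.IsGeneralizedPolygon n) (h' : Γ'.IsGeneralizedPolygon n')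
    (ho : Γ.HasOrder s t) (ho' : Γ'.HasOrder s' t')
    (heq : spectrum ℝ Γ.collinearityMatrix = spectrum ℝ Γ'.collinearityMatrix) :
    n = n' ∧ s = s' ∧ t = t' := by
  have hcard : n / 2 + 1 = n' / 2 + 1 := by
    rw [← (h.spectrum_collinearityMatrix ho).2, heq, (h'.spectrum_collinearityMatrix ho').2]
  have hmax : s * (t + 1) = s' * (t' + 1) := by
    have h1 := h'.le_of_mem_spectrum ho' (heq ▸ (h.mem_spectrum_iff ho).2 (.inl rfl))
    have h2 := h.le_of_mem_spectrum ho (heq ▸ (h'.mem_spectrum_iff ho').2 (.inl rfl))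
    exact_mod_cast le_antisymm h1 h2
  -- For even `n` the least eigenvalue gives `t`, then the largest gives `s`. For odd `n` one has `s
  -- = t`, and `s * (s + 1)` determines `s`. Parity and `n / 2` give `n`.
  by_cases hn : Even n
  · have hn' := even_of_spectrum_eq h h' ho ho' heq hn
    have h1 := h'.neg_le_of_mem_spectrum ho' (heq ▸ h.neg_mem_spectrum_of_even ho hn)
    have h2 := h.neg_le_of_mem_spectrum ho (heq ▸ h'.neg_mem_spectrum_of_even ho' hn')
    have ht : t = t' := by
      have : (t : ℝ) = t' := by linarith
      exact_mod_cast this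
    subst ht
    refine ⟨?_, Nat.eq_of_mul_eq_mul_right (Nat.succ_pos t) hmax, rfl⟩
    rw [Nat.even_iff] at hn hn'
    omega
  · have hn' : ¬ Even n' := fun hn' => hn (even_of_spectrum_eq h' h ho' ho heq.symm hn')
    rw [Nat.not_even_iff_odd] at hn hn'
    obtain rfl := h.order_eq_of_odd hn ho
    obtain rfl := h'.order_eq_of_odd hn' ho'
    have hs : s = s' := by
      rcases lt_trichotomy s s' with hlt | he | hlt
      · nlinarith
      · exact he
      · nlinarith
    refine ⟨?_, hs, hs⟩
    rw [Nat.odd_iff] at hn hn'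
    omega

end Comparison
end PointLineGeometry

theorem mainTheorem2 {P L P' L' : Type*} [Fintype P] [DecidableEq P] [Finite L]
    [Fintype P'] [DecidableEq P'] [Finite L']
    (Γ : PointLineGeometry P L) (Γ' : PointLineGeometry P' L') (n n' : ℕ)
    (hΓ : Γ.IsGeneralizedPolygon n) (hΓ' : Γ'.IsGeneralizedPolygon n') :
    (Γ.pointSpectrum = Γ'.pointSpectrum ↔ n = n' ∧ Γ.SameOrder Γ') ∧
    (spectrum ℝ Γ.collinearityMatrix = spectrum ℝ Γ'.collinearityMatrix ↔
      n = n' ∧ Γ.SameOrder Γ') := by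
  have hforward (heq : spectrum ℝ Γ.collinearityMatrix = spectrum ℝ Γ'.collinearityMatrix) :
      n = n' ∧ Γ.SameOrder Γ' := by
    obtain ⟨s, t, ho⟩ := hΓ.exists_hasOrder
    obtain ⟨s', t', ho'⟩ := hΓ'.exists_hasOrder
    obtain ⟨hn, rfl, rfl⟩ := PointLineGeometry.eq_of_spectrum_eq hΓ hΓ' ho ho' heq
    exact ⟨hn, s, t, ho, ho'⟩
  have hbackward : n = n' ∧ Γ.SameOrder Γ' → Γ.pointSpectrum = Γ'.pointSpectrum := by
    rintro ⟨rfl, s, t, ho, ho'⟩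
    exact hΓ.pointSpectrum_eq hΓ' ho ho'
  exact ⟨⟨fun h => hforward (PointLineGeometry.spectrum_eq_of_pointSpectrum_eq h), hbackward⟩,
    hforward, fun h => PointLineGeometry.spectrum_eq_of_pointSpectrum_eq (hbackward h)⟩
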